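/- Let $X$ be a finite set and let $X^\omega$ be the space of infinite words over $X$ with the metric $d(u,v)=2^{-|u\wedge v|}$ for $u\neq v$, where $u\wedge v$ is the longest common prefix. Let $(G,X)$ be a contracting self-similar group: $G$ is a group acting faithfully by isometries on $X^\omega$ such that for all $g\in G$, $x\in X$ there are $g(x)\in X$ and $g|_x\in G$ with $g(xw)=g(x)\,g|_x(w)$ for all $w\in X^\omega$; one puts $g|_\emptyset=g$, $g|_{xu}=(g|_x)|_u$ for finite words; and there is a finite set $N\subseteq G$ such that (a) $n|_x\in N$ for all $n\in N$, $x\in X$, and (b) for every $g\in G$ there is $m\ge 0$ with $g|_w\in N$ for all $w\in X^m$. The nucleus $\mathcal N$ is the smallest finite set with (a) and (b). Let $S(G,X)$ be the inverse semigroup with zero generated by the group elements $u_g$ ($g\in G$, with $u_gu_h=u_{gh}$ and $u_g^*=u_{g^{-1}}$) and by $s_x$ ($x\in X$), subject to $u_g s_x=s_{g(x)}u_{g|_x}$ and $s_x^*s_y=\delta_{x,y}$; its nonzero elements are uniquely of the form $s_v u_g s_w^*$ with $v,w$ finite words and $g\in G$. It acts on $X^\omega$ by the partial homeomorphisms $s_vu_gs_w^*\colon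 w\xi\mapsto v\,g(\xi)$ with domain $wX^\omega$. Let $\mathcal G(G,X)$ be the groupoid of germs $[s,\rho]$ of this action (where $[s,\rho]=[t,\rho]$ if $se=te$ for an idempotent $e\in S(G,X)$ whose domain contains $\rho$), with the topology that has as a basis the sets $\{[s,\rho]:\rho\in U\}$ for $s\in S(G,X)$ and $U$ open in the domain of $s$. Let $\mathcal G(G,X)_0$ be its open subgroupoid of germs $[s_vu_gs_w^*,\rho]$ with $|v|=|w|$. For an ample groupoid $\mathcal G$, let $\mathbb C\mathcal G$ be the convolution algebra of functions $\mathcal G\to\mathbb C$ spanned by the indicator functions of compact open bisections, and let the algebraic essential ideal $I^{\mathrm{alg}}_{\mathrm{ess}}(\mathcal G)$ be the set of $f\in\mathbb C\mathcal G$ such that $\{\gamma: f(\gamma)\ne 0\}$ has empty interior in $\mathcal G$. Let $\mathbb C\mathcal N$ be the linear span of the indicator functions of the sets of germs $\{[u_g,\rho]:\rho\in X^\omega\}$ for $g\in\mathcal N$; it is contained in $\mathbb C\mathcal G(G,X)_0\subseteq\mathbb C\mathcal G(G,X)$ (functions on $\mathcal G(G,X)_0$ being extended by zero). Then: 1. $I^{\mathrm{alg}}_{\mathrm{ess}}(\mathcal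 G(G,X))$ is the two-sided ideal of $\mathbb C\mathcal G(G,X)$ generated by $I^{\mathrm{alg}}_{\mathrm{ess}}(\mathcal G(G,X))\cap\mathbb C\mathcal N$; 2. $I^{\mathrm{alg}}_{\mathrm{ess}}(\mathcal G(G,X)_0)$ is the two-sided ideal of $\mathbb C\mathcal G(G,X)_0$ generated by $I^{\mathrm{alg}}_{\mathrm{ess}}(\mathcal G(G,X)_0)\cap\mathbb C\mathcal N$. -/

import Mathlib

set_option linter.unusedSectionVars false

noncomputable section

/-! ## Groupoids, their complex algebras and essential ideals -/

/-- A groupoid with set of arrows `Γ` and set of units (objects) `Ob`. The product `mul a b`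
is defined exactly when the source of `a` is the range of `b`. -/
class ArrowGroupoid (Γ : Type*) (Ob : outParam Type*) where
  src : Γ → Ob
  tgt : Γ → Ob
  unit : Ob → Γ
  inv : Γ → Γ
  mul : (a b : Γ) → src a = tgt b → Γ
  src_unit : ∀ x, src (unit x) = x
  tgt_unit : ∀ x, tgt (unit x) = x
  src_inv : ∀ a, src (inv a) = tgt a
  tgt_inv : ∀ a, tgt (inv a) = src a
  src_mul : ∀ a b (h : src a = tgt b), src (mul a b h) = src b
  tgt_mul : ∀ a b (h : src a = tgt b), tgt (mul a b h) = tgt a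
  unit_mul : ∀ a, mul (unit (tgt a)) a (src_unit _) = a
  mul_unit : ∀ a, mul a (unit (src a)) (tgt_unit _).symm = a
  inv_mul : ∀ a, mul (inv a) a (src_inv a) = unit (src a)
  mul_inv : ∀ a, mul a (inv a) (tgt_inv a).symm = unit (tgt a)
  mul_assoc : ∀ a b c (h₁ : src a = tgt b) (h₂ : src b = tgt c),
    mul (mul a b h₁) c ((src_mul a b h₁).trans h₂) =
      mul a (mul b c h₂) (h₁.trans (tgt_mul b c h₂).symm)

namespace ArrowGroupoid

section Algebra

variable (Γ : Type*) {Ob : Type*} [ArrowGroupoid Γ Ob] [TopologicalSpace Γ] [TopologicalSpace Ob]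

variable {Γ} in
/-- A bisection: source and range restrict to homeomorphisms of `F` onto their images. -/
def IsBisection (F : Set Γ) : Prop :=
  Topology.IsEmbedding (F.domRestrict (src : Γ → Ob)) ∧
    Topology.IsEmbedding (F.domRestrict (tgt : Γ → Ob))

/-- The complex algebra of an ample groupoid (as a space of functions on the set of arrows):
the linear span of the indicator functions of the compact open bisections. -/
def algebra : Submodule ℂ (Γ → ℂ) :=
  Submodule.span ℂ {f | ∃ F : Set Γ, IsCompact F ∧ IsOpen F ∧ IsBisection F ∧
    f = F.indicator 1}

variable {Γ} in
/-- Convolution: `(f₁ f₂)(γ)` is the sum of `f₁ γ₁ * f₂ γ₂` over all factorizations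
`γ₁ γ₂ = γ`. (For `f₁`, `f₂` in the algebra only finitely many terms are nonzero.) -/
def conv (f₁ f₂ : Γ → ℂ) (γ : Γ) : ℂ :=
  ∑ᶠ p : {p : Γ × Γ // ∃ h : src p.1 = tgt p.2, mul p.1 p.2 h = γ}, f₁ p.1.1 * f₂ p.1.2

/-- The algebraic essential ideal: the elements of the algebra whose strict support
has empty interior in `Γ`. (An element of the algebra, viewed in the reduced C*-algebra, has
itself as its associated function on `Γ`.) -/
def essentialIdeal : Set (Γ → ℂ) :=
  {f | f ∈ algebra Γ ∧ interior (Function.support f) = ∅}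

/-- The two-sided ideal of the algebra of `Γ` generated by a set `S` of its elements: the
smallest linear subspace of the algebra that contains `S` and is stable under left and right
multiplication by all elements of the algebra. -/
def idealGeneratedBy (S : Set (Γ → ℂ)) : Submodule ℂ (Γ → ℂ) :=
  sInf {I | I ≤ algebra Γ ∧ S ⊆ I ∧
    ∀ a ∈ algebra Γ, ∀ f ∈ I, conv a f ∈ I ∧ conv f a ∈ I}

end Algebra

end ArrowGroupoid

/-! ## Self-similar groups -/

/-- The space `X^ω` of infinite words over `X`, with the metric `d(u, v) = 2 ^ (-n)`, where `n` is
the length of the longest common prefix of `u ≠ v`. Its topology is the product of the discrete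
topologies. -/
instance infiniteWordMetric (X : Type*) : MetricSpace (Stream' X) :=
  letI : TopologicalSpace X := ⊥
  haveI : DiscreteTopology X := ⟨rfl⟩
  (PiNat.metricSpace : MetricSpace (ℕ → X))

open scoped Stream'

/-- Self-similarity of an action of `G` on `X^ω`: for all `g` and `x` there is `g|_x` in `G` such
that `g(xw) = g(x) g|_x(w)` for all `w` (where `g(x)` is a letter). -/
class IsSelfSimilar (G X : Type*) [Group G] [MulAction G (Stream' X)] : Prop where
  exists_section : ∀ (g : G) (x : X), ∃ (y : X) (h : G), ∀ w : Stream' X,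
    g • (x :: w) = y :: (h • w)

namespace SelfSimilar

section Sections

variable {G X : Type*} [Group G] [MulAction G (Stream' X)] [IsSelfSimilar G X]

/-- The letter `g(x)`. -/
def letter (g : G) (x : X) : X := (IsSelfSimilar.exists_section g x).choose

/-- The section `g|_x`. -/
def sect (g : G) (x : X) : G := (IsSelfSimilar.exists_section g x).choose_spec.choose

theorem smul_cons (g : G) (x : X) (w : Stream' X) :
    g • (x :: w) = letter g x :: (sect g x • w) :=
  (IsSelfSimilar.exists_section g x).choose_spec.choose_spec w

/-- The section `g|_w` at a finite word: `g|_∅ = g` and `g|_{xu} = (g|_x)|_u`. -/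
def wordSect (g : G) : List X → G
  | .nil => g
  | .cons x u => wordSect (sect g x) u

variable (G X) in
/-- A finite subset of `G` that is closed under sections and eventually absorbs the sections of
every element of `G`. -/
structure IsAbsorbing (N : Set G) : Prop where
  finite : N.Finite
  sect_mem : ∀ n ∈ N, ∀ x : X, sect n x ∈ N
  absorbs : ∀ g : G, ∃ m : ℕ, ∀ w : List X, w.length = m → wordSect g w ∈ N

variable (G X) in
/-- The self-similar group `(G, X)` is contracting. -/
def IsContracting : Prop := ∃ N : Set G, IsAbsorbing G X N

variable (G X) in
/-- The nucleus of `(G, X)`; by `isLeast_nucleus` it is the smallest finite set as in the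
definition of contraction. -/
def nucleus : Set G := ⋂₀ {N | IsAbsorbing G X N}

theorem wordSect_append (g : G) (u v : List X) :
    wordSect g (u ++ v) = wordSect (wordSect g u) v := by
  induction u generalizing g with
  | nil => rfl
  | cons x u ih => exact ih _

theorem IsAbsorbing.wordSect_mem {N : Set G} (hN : IsAbsorbing G X N) {g : G} (hg : g ∈ N)
    (w : List X) : wordSect g w ∈ N := by
  induction w generalizing g with
  | nil => exact hg
  | cons x u ih => exact ih (hN.sect_mem g hg x)

theorem IsAbsorbing.wordSect_mem_of_le {N : Set G} (hN : IsAbsorbing G X N) {g : G} {m k : ℕ}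
    (hm : ∀ w : List X, w.length = m → wordSect g w ∈ N) (hk : m ≤ k) (w : List X)
    (hw : w.length = k) : wordSect g w ∈ N := by
  rw [← List.take_append_drop m w, wordSect_append]
  exact hN.wordSect_mem (hm _ (by simp [hw, hk])) _

theorem IsAbsorbing.inter {N N' : Set G} (hN : IsAbsorbing G X N) (hN' : IsAbsorbing G X N') :
    IsAbsorbing G X (N ∩ N') where
  finite := hN.finite.inter_of_left _
  sect_mem n hn x := ⟨hN.sect_mem n hn.1 x, hN'.sect_mem n hn.2 x⟩
  absorbs g := by
    obtain ⟨m, hm⟩ := hN.absorbs g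
    obtain ⟨m', hm'⟩ := hN'.absorbs g
    exact ⟨max m m', fun w hw => ⟨hN.wordSect_mem_of_le hm (le_max_left _ _) w hw,
      hN'.wordSect_mem_of_le hm' (le_max_right _ _) w hw⟩⟩

theorem isLeast_nucleus (h : IsContracting G X) :
    IsLeast {N | IsAbsorbing G X N} (nucleus G X) := by
  refine ⟨?_, fun N hN => Set.sInter_subset_of_mem hN⟩
  obtain ⟨N₀, hN₀⟩ := h
  -- an absorbing set of minimal cardinality is the smallest one
  have hne : ∃ k : ℕ, ∃ N : Set G, IsAbsorbing G X N ∧ N.ncard = k := ⟨_, N₀, hN₀, rfl⟩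
  classical
  obtain ⟨N, hN, hk⟩ := Nat.find_spec hne
  have hmin : ∀ N', IsAbsorbing G X N' → N ⊆ N' := by
    intro N' hN'
    have h1 := Nat.find_min' hne ⟨N ∩ N', hN.inter hN', rfl⟩
    have h2 : N ∩ N' = N :=
      Set.eq_of_subset_of_ncard_le Set.inter_subset_left (hk.trans_le h1) hN.finite
    exact h2 ▸ Set.inter_subset_right
  have : nucleus G X = N :=
    Set.Subset.antisymm (Set.sInter_subset_of_mem hN) (Set.subset_sInter hmin)
  rw [Set.mem_ofPred_eq, this]
  exact hN

end Sections

section SectionRules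

variable {G X : Type*} [Group G] [MulAction G (Stream' X)] [IsSelfSimilar G X]
  [FaithfulSMul G (Stream' X)]

theorem letter_sect_unique {g h : G} {x y : X}
    (H : ∀ w : Stream' X, g • (x :: w) = y :: (h • w)) : letter g x = y ∧ sect g x = h := by
  have H' : ∀ w : Stream' X, letter g x = y ∧ sect g x • w = h • w := fun w =>
    Stream'.cons_injective2 ((smul_cons g x w).symm.trans (H w))
  exact ⟨(H' (Stream'.const x)).1, FaithfulSMul.eq_of_smul_eq_smul fun w => (H' w).2⟩

theorem letter_sect_one (x : X) : letter (1 : G) x = x ∧ sect (1 : G) x = 1 :=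
  letter_sect_unique fun w => by simp

theorem letter_sect_mul (g h : G) (x : X) :
    letter (g * h) x = letter g (letter h x) ∧
      sect (g * h) x = sect g (letter h x) * sect h x :=
  letter_sect_unique fun w => by simp [mul_smul, smul_cons]

theorem letter_sect_inv (g : G) (x : X) :
    letter g⁻¹ (letter g x) = x ∧ sect g⁻¹ (letter g x) = (sect g x)⁻¹ :=
  letter_sect_unique fun w => by
    rw [inv_smul_eq_iff, smul_cons, smul_inv_smul]

end SectionRules

/-! ## The groupoid of germs -/

/-- A representative of a germ: the nonzero element `s_v u_g s_w^*` of the inverse semigroup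
`S(G, X)` together with the point `w ξ` of its domain `w X^ω`. -/
@[ext]
structure PreGerm (G X : Type*) where
  v : List X
  g : G
  w : List X
  ξ : Stream' X

namespace PreGerm

section

variable {G X : Type*} [Group G] [MulAction G (Stream' X)]

/-- The point `w ξ` at which the germ is taken. -/
def src (p : PreGerm G X) : Stream' X := p.w ++ₛ p.ξ

/-- The image `v g(ξ)` of `w ξ` under `s_v u_g s_w^*`. -/
def tgt (p : PreGerm G X) : Stream' X := p.v ++ₛ (p.g • p.ξ)

/-- The value `|v| - |w|` of the cocycle. -/
def deg (p : PreGerm G X) : ℤ := (p.v.length : ℤ) - (p.w.length : ℤ)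

/-- `(s_v u_g s_w^*)^* = s_w u_{g⁻¹} s_v^*`, at the point `v g(ξ)`. -/
def inv (p : PreGerm G X) : PreGerm G X := ⟨p.w, p.g⁻¹, p.v, p.g • p.ξ⟩

/-- The product `s_v u_g s_w^* · s_{v'} u_h s_{w'}^*`, at the point `w' ξ'`, when `w = v'`
and `ξ = h(ξ')`. -/
def mul (p q : PreGerm G X) : PreGerm G X := ⟨p.v, p.g * q.g, q.w, q.ξ⟩

/-- The condition under which `mul` is used. -/
def Aligned (p q : PreGerm G X) : Prop := p.w = q.v ∧ p.ξ = q.g • q.ξ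

variable [IsSelfSimilar G X]

/-- Restriction of `s_v u_g s_w^*` to the smaller neighbourhood `w x X^ω` of the point
`w ξ`, where `x` is the first letter of `ξ`: multiplication on the right by the idempotent
`s_{wx} s_{wx}^*` gives `s_v u_g s_w^* s_{wx} s_{wx}^* = s_{v g(x)} u_{g|_x} s_{wx}^*`. -/
def step (p : PreGerm G X) : PreGerm G X :=
  ⟨p.v ++ [letter p.g p.ξ.head], sect p.g p.ξ.head, p.w ++ [p.ξ.head], p.ξ.tail⟩

/-- Two representatives define the same germ if they are taken at the same point and have equal
products with some idempotent `s_u s_u^*` whose domain `u X^ω` contains that point. -/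
instance germSetoid (G X : Type*) [Group G] [MulAction G (Stream' X)] [IsSelfSimilar G X] :
    Setoid (PreGerm G X) where
  r p q := ∃ m n : ℕ, step^[m] p = step^[n] q
  iseqv := by
    refine ⟨fun p => ⟨0, 0, rfl⟩, fun ⟨m, n, h⟩ => ⟨n, m, h.symm⟩, ?_⟩
    rintro p q r ⟨m, n, h⟩ ⟨m', n', h'⟩
    refine ⟨m' + m, n + n', ?_⟩
    rw [Function.iterate_add_apply, h, ← Function.iterate_add_apply, add_comm m' n,
      Function.iterate_add_apply, h', ← Function.iterate_add_apply]

theorem equiv_def {p q : PreGerm G X} : p ≈ q ↔ ∃ m n : ℕ, step^[m] p = step^[n] q := Iff.rfl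

theorem iterate_equiv (p : PreGerm G X) (n : ℕ) : step^[n] p ≈ p := ⟨0, n, rfl⟩

theorem iterate_eq_of_step {α : Sort*} {f : PreGerm G X → α} (h : ∀ p, f (step p) = f p) (n : ℕ)
    (p : PreGerm G X) : f (step^[n] p) = f p := by
  induction n with
  | zero => rfl
  | succ n ih => rw [Function.iterate_succ_apply', h, ih]

theorem eq_of_equiv {α : Sort*} {f : PreGerm G X → α} (h : ∀ p, f (step p) = f p)
    (p q : PreGerm G X) (hpq : p ≈ q) : f p = f q := by
  obtain ⟨m, n, e⟩ := hpq
  rw [← iterate_eq_of_step h m, e, iterate_eq_of_step h]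

theorem src_step (p : PreGerm G X) : (step p).src = p.src := by
  simp only [src, step, Stream'.append_append_stream, Stream'.append_stream_head_tail]

theorem tgt_step (p : PreGerm G X) : (step p).tgt = p.tgt := by
  have : p.g • p.ξ = letter p.g p.ξ.head :: (sect p.g p.ξ.head • p.ξ.tail) := by
    rw [← smul_cons, Stream'.eta]
  simp only [tgt, step, Stream'.append_append_stream, this]
  rfl

theorem deg_step (p : PreGerm G X) : (step p).deg = p.deg := by
  simp [deg, step]

theorem length_v_iterate (p : PreGerm G X) (n : ℕ) :
    (step^[n] p).v.length = p.v.length + n := by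
  induction n with
  | zero => rfl
  | succ n ih => rw [Function.iterate_succ_apply', step, List.length_append, ih]; rfl

theorem length_w_iterate (p : PreGerm G X) (n : ℕ) :
    (step^[n] p).w.length = p.w.length + n := by
  induction n with
  | zero => rfl
  | succ n ih => rw [Function.iterate_succ_apply', step, List.length_append, ih]; rfl

theorem append_stream_inj {u v : List X} {ξ η : Stream' X} (h : u ++ₛ ξ = v ++ₛ η)
    (hl : u.length = v.length) : u = v ∧ ξ = η := by
  induction u generalizing v with
  | nil =>
    cases v with
    | nil => exact ⟨rfl, h⟩
    | cons y v => simp at hl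
  | cons x u ih =>
    cases v with
    | nil => simp at hl
    | cons y v =>
      have h' := Stream'.cons_injective2 h
      have := ih h'.2 (by simpa using hl)
      exact ⟨by rw [h'.1, this.1], this.2⟩

theorem Aligned.src_eq {p q : PreGerm G X} (h : Aligned p q) : p.src = q.tgt := by
  rw [src, tgt, h.1, h.2]

theorem aligned_of_length {p q : PreGerm G X} (h : p.src = q.tgt)
    (hl : p.w.length = q.v.length) : Aligned p q := append_stream_inj h hl

/-- Any two composable germs have representatives to which `mul` applies. -/
theorem aligned_iterate {p q : PreGerm G X} (h : p.src = q.tgt) :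
    Aligned (step^[q.v.length] p) (step^[p.w.length] q) := by
  apply aligned_of_length
  · rw [iterate_eq_of_step src_step, iterate_eq_of_step tgt_step, h]
  · rw [length_v_iterate, length_w_iterate, add_comm]

theorem Aligned.iterate {p q : PreGerm G X} (h : Aligned p q) (n : ℕ) :
    Aligned (step^[n] p) (step^[n] q) := by
  apply aligned_of_length
  · rw [iterate_eq_of_step src_step, iterate_eq_of_step tgt_step, h.src_eq]
  · rw [length_v_iterate, length_w_iterate, h.1]

variable [FaithfulSMul G (Stream' X)]

theorem inv_step (p : PreGerm G X) : (step p).inv = step p.inv := by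
  have h : p.g • p.ξ = letter p.g p.ξ.head :: (sect p.g p.ξ.head • p.ξ.tail) := by
    rw [← smul_cons, Stream'.eta]
  have h1 := (letter_sect_inv p.g p.ξ.head).1
  have h2 := (letter_sect_inv p.g p.ξ.head).2
  simp only [inv, step, h, Stream'.head_cons, Stream'.tail_cons, h1, h2]

theorem Aligned.mul_step {p q : PreGerm G X} (h : Aligned p q) :
    mul (step p) (step q) = step (mul p q) := by
  have hq : q.g • q.ξ = letter q.g q.ξ.head :: (sect q.g q.ξ.head • q.ξ.tail) := by
    rw [← smul_cons, Stream'.eta]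
  have h1 := (letter_sect_mul p.g q.g q.ξ.head).1
  have h2 := (letter_sect_mul p.g q.g q.ξ.head).2
  simp only [mul, step, h.2, hq, Stream'.head_cons, h1, h2]

theorem Aligned.mul_iterate {p q : PreGerm G X} (h : Aligned p q) (n : ℕ) :
    mul (step^[n] p) (step^[n] q) = step^[n] (mul p q) := by
  induction n with
  | zero => rfl
  | succ n ih =>
    rw [Function.iterate_succ_apply', Function.iterate_succ_apply', Function.iterate_succ_apply',
      (h.iterate n).mul_step, ih]

theorem inv_equiv {p q : PreGerm G X} (h : p ≈ q) : p.inv ≈ q.inv := by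
  have key : ∀ (n : ℕ) (p : PreGerm G X), (step^[n] p).inv = step^[n] p.inv := by
    intro n p
    induction n with
    | zero => rfl
    | succ n ih => rw [Function.iterate_succ_apply', inv_step, ih, Function.iterate_succ_apply']
  obtain ⟨m, n, e⟩ := h
  exact ⟨m, n, by rw [← key, e, key]⟩

theorem mul_equiv {p q p' q' : PreGerm G X} (h : Aligned p q) (h' : Aligned p' q')
    (hp : p ≈ p') (hq : q ≈ q') : mul p q ≈ mul p' q' := by
  obtain ⟨m, n, e⟩ := hp
  obtain ⟨k, l, e'⟩ := hq
  have e1 : p.w.length + m = p'.w.length + n := by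
    rw [← length_w_iterate, e, length_w_iterate]
  have e2 : q.v.length + k = q'.v.length + l := by
    rw [← length_v_iterate, e', length_v_iterate]
  have e3 := congrArg List.length h.1
  have e4 := congrArg List.length h'.1
  have e5 : k + n = m + l := by omega
  refine ⟨k + m, k + n, ?_⟩
  rw [← h.mul_iterate, ← h'.mul_iterate]
  have a1 : step^[k + m] p = step^[k + n] p' := by
    rw [Function.iterate_add_apply, e, ← Function.iterate_add_apply]
  have a2 : step^[k + m] q = step^[k + n] q' := by
    rw [add_comm, Function.iterate_add_apply, e', ← Function.iterate_add_apply, e5]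
  rw [a1, a2]

/-- The germ of an idempotent `s_v s_v^*` at `v ξ` is a unit. -/
theorem unit_equiv (v : List X) (ξ : Stream' X) :
    (⟨v, 1, v, ξ⟩ : PreGerm G X) ≈ ⟨[], 1, [], v ++ₛ ξ⟩ := by
  refine Setoid.symm ⟨v.length, 0, ?_⟩
  have key : ∀ (u : List X), step^[v.length] (⟨u, 1, u, v ++ₛ ξ⟩ : PreGerm G X) =
      ⟨u ++ v, 1, u ++ v, ξ⟩ := by
    induction v with
    | nil => intro u; simp
    | cons x v ih =>
      intro u
      have h1 := (letter_sect_one (G := G) x).1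
      have h2 := (letter_sect_one (G := G) x).2
      rw [List.length_cons, Function.iterate_succ_apply]
      simp only [step, Stream'.cons_append_stream, Stream'.head_cons, Stream'.tail_cons, h1, h2]
      rw [ih]
      simp
  simpa using key []

end

end PreGerm

/-- The groupoid `𝒢(G, X)` of germs of the action of the inverse semigroup `S(G, X)`
on `X^ω`. -/
def Germ (G X : Type*) [Group G] [MulAction G (Stream' X)] [IsSelfSimilar G X] : Type _ :=
  Quotient (PreGerm.germSetoid G X)

namespace Germ

section

variable {G X : Type*} [Group G] [MulAction G (Stream' X)] [IsSelfSimilar G X]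

/-- The germ `[s_v u_g s_w^*, w ξ]`. -/
def mk (p : PreGerm G X) : Germ G X := Quotient.mk _ p

theorem exists_mk (a : Germ G X) : ∃ p, mk p = a := Quotient.exists_rep a

theorem mk_eq_mk {p q : PreGerm G X} : mk p = mk q ↔ p ≈ q := Quotient.eq

/-- The source of a germ: `w ξ` for `[s_v u_g s_w^*, w ξ]`. -/
def src : Germ G X → Stream' X :=
  Quotient.lift PreGerm.src (PreGerm.eq_of_equiv PreGerm.src_step)

/-- The range of a germ: `v g(ξ)` for `[s_v u_g s_w^*, w ξ]`. -/
def tgt : Germ G X → Stream' X :=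
  Quotient.lift PreGerm.tgt (PreGerm.eq_of_equiv PreGerm.tgt_step)

/-- The cocycle: `|v| - |w|` for `[s_v u_g s_w^*, w ξ]`. -/
def deg : Germ G X → ℤ :=
  Quotient.lift PreGerm.deg (PreGerm.eq_of_equiv PreGerm.deg_step)

theorem exists_aligned (a b : Germ G X) (h : src a = tgt b) :
    ∃ pq : PreGerm G X × PreGerm G X, PreGerm.Aligned pq.1 pq.2 ∧ mk pq.1 = a ∧ mk pq.2 = b := by
  obtain ⟨p, rfl⟩ := exists_mk a
  obtain ⟨q, rfl⟩ := exists_mk b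
  exact ⟨(_, _), PreGerm.aligned_iterate h, mk_eq_mk.2 (PreGerm.iterate_equiv _ _),
    mk_eq_mk.2 (PreGerm.iterate_equiv _ _)⟩

/-- The product of composable germs, see `mul_mk`. -/
def mul (a b : Germ G X) (h : src a = tgt b) : Germ G X :=
  mk (PreGerm.mul (exists_aligned a b h).choose.1 (exists_aligned a b h).choose.2)

variable [FaithfulSMul G (Stream' X)]

/-- `[s_v u_g s_w^*, w h(ξ)] · [s_w u_h s_u^*, u ξ] = [s_v u_{gh} s_u^*, u ξ]`. -/
theorem mul_mk {p q : PreGerm G X} (h : PreGerm.Aligned p q) :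
    mul (mk p) (mk q) h.src_eq = mk (PreGerm.mul p q) := by
  obtain ⟨h1, h2, h3⟩ := (exists_aligned (mk p) (mk q) h.src_eq).choose_spec
  exact mk_eq_mk.2 (PreGerm.mul_equiv h1 h (mk_eq_mk.1 h2) (mk_eq_mk.1 h3))

/-- The inverse of a germ: `[s_w u_{g⁻¹} s_v^*, v g(ξ)]` for `[s_v u_g s_w^*, w ξ]`. -/
def inv : Germ G X → Germ G X :=
  Quotient.map PreGerm.inv fun _ _ => PreGerm.inv_equiv

theorem src_mul (a b : Germ G X) (h : src a = tgt b) : src (mul a b h) = src b := by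
  obtain ⟨⟨p, q⟩, hpq, rfl, rfl⟩ := exists_aligned a b h
  rw [mul_mk hpq]; rfl

theorem tgt_mul (a b : Germ G X) (h : src a = tgt b) : tgt (mul a b h) = tgt a := by
  obtain ⟨⟨p, q⟩, hpq, rfl, rfl⟩ := exists_aligned a b h
  rw [mul_mk hpq]
  change p.v ++ₛ ((p.g * q.g) • q.ξ) = p.v ++ₛ (p.g • p.ξ)
  rw [hpq.2, mul_smul]

theorem deg_mul (a b : Germ G X) (h : src a = tgt b) : deg (mul a b h) = deg a + deg b := by
  obtain ⟨⟨p, q⟩, hpq, rfl, rfl⟩ := exists_aligned a b h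
  rw [mul_mk hpq]
  change (p.v.length : ℤ) - q.w.length = (p.v.length - p.w.length) + (q.v.length - q.w.length)
  rw [hpq.1]; ring

theorem deg_inv (a : Germ G X) : deg (inv a) = - deg a := by
  obtain ⟨p, rfl⟩ := exists_mk a
  change (p.w.length : ℤ) - p.v.length = -(p.v.length - p.w.length)
  ring

theorem mk_unit (v : List X) (ξ : Stream' X) :
    (mk ⟨v, 1, v, ξ⟩ : Germ G X) = mk ⟨[], 1, [], v ++ₛ ξ⟩ := mk_eq_mk.2 (PreGerm.unit_equiv v ξ)

theorem mul_congr {a a' b b' : Germ G X} (ha : a = a') (hb : b = b') (h : src a = tgt b)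
    (h' : src a' = tgt b') : mul a b h = mul a' b' h' := by
  subst ha hb; rfl

theorem mul_assoc (a b c : Germ G X) (h₁ : src a = tgt b) (h₂ : src b = tgt c) :
    mul (mul a b h₁) c ((src_mul a b h₁).trans h₂) =
      mul a (mul b c h₂) (h₁.trans (tgt_mul b c h₂).symm) := by
  obtain ⟨⟨p, q⟩, hpq, rfl, rfl⟩ := exists_aligned a b h₁
  obtain ⟨r, rfl⟩ := exists_mk c
  -- refine all three representatives so that both products are computed by `PreGerm.mul`
  have hqr := PreGerm.aligned_iterate (p := q) (q := r) h₂
  have hpq' := PreGerm.Aligned.iterate hpq r.v.length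
  have ep : mk p = mk (PreGerm.step^[r.v.length] p) :=
    (mk_eq_mk.2 (PreGerm.iterate_equiv _ _)).symm
  have eq : mk q = mk (PreGerm.step^[r.v.length] q) :=
    (mk_eq_mk.2 (PreGerm.iterate_equiv _ _)).symm
  have er : mk r = mk (PreGerm.step^[q.w.length] r) :=
    (mk_eq_mk.2 (PreGerm.iterate_equiv _ _)).symm
  generalize PreGerm.step^[r.v.length] p = p' at *
  generalize PreGerm.step^[r.v.length] q = q' at *
  generalize PreGerm.step^[q.w.length] r = r' at *
  have f1 : mul (mk p) (mk q) h₁ = mk (PreGerm.mul p' q') := by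
    rw [← mul_mk hpq']; exact mul_congr ep eq _ _
  have f2 : mul (mk q) (mk r) h₂ = mk (PreGerm.mul q' r') := by
    rw [← mul_mk hqr]; exact mul_congr eq er _ _
  have g1 : PreGerm.Aligned (PreGerm.mul p' q') r' := hqr
  have g2 : PreGerm.Aligned p' (PreGerm.mul q' r') :=
    ⟨hpq'.1, by
      change p'.ξ = (q'.g * r'.g) • r'.ξ
      rw [hpq'.2, hqr.2, mul_smul]⟩
  rw [mul_congr f1 er _ g1.src_eq, mul_congr ep f2 _ g2.src_eq, mul_mk g1, mul_mk g2]
  simp only [PreGerm.mul, _root_.mul_assoc]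

end

section

variable {G X : Type*} [Group G] [MulAction G (Stream' X)] [IsSelfSimilar G X]

instance [FaithfulSMul G (Stream' X)] : ArrowGroupoid (Germ G X) (Stream' X) where
  src := src
  tgt := tgt
  unit x := mk ⟨[], 1, [], x⟩
  inv := inv
  mul := mul
  src_unit _ := rfl
  tgt_unit x := one_smul G x
  src_inv a := by
    obtain ⟨p, rfl⟩ := exists_mk a
    rfl
  tgt_inv a := by
    obtain ⟨p, rfl⟩ := exists_mk a
    exact congrArg (p.w ++ₛ ·) (inv_smul_smul p.g p.ξ)
  src_mul := src_mul
  tgt_mul := tgt_mul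
  unit_mul a := by
    obtain ⟨p, rfl⟩ := exists_mk a
    have h : PreGerm.Aligned ⟨p.v, 1, p.v, p.g • p.ξ⟩ p := ⟨rfl, rfl⟩
    refine (mul_congr (mk_unit p.v (p.g • p.ξ)).symm (rfl : mk p = mk p) _ h.src_eq).trans ?_
    rw [mul_mk h]
    simp [PreGerm.mul]
  mul_unit a := by
    obtain ⟨p, rfl⟩ := exists_mk a
    have h : PreGerm.Aligned p ⟨p.w, 1, p.w, p.ξ⟩ := ⟨rfl, (one_smul G p.ξ).symm⟩
    refine (mul_congr (rfl : mk p = mk p) (mk_unit p.w p.ξ).symm _ h.src_eq).trans ?_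
    rw [mul_mk h]
    simp [PreGerm.mul]
  inv_mul a := by
    obtain ⟨p, rfl⟩ := exists_mk a
    have h : PreGerm.Aligned p.inv p := ⟨rfl, rfl⟩
    refine (mul_mk h).trans ?_
    simp only [PreGerm.mul, PreGerm.inv, inv_mul_cancel]
    exact mk_unit p.w p.ξ
  mul_inv a := by
    obtain ⟨p, rfl⟩ := exists_mk a
    have h : PreGerm.Aligned p p.inv := ⟨rfl, (inv_smul_smul p.g p.ξ).symm⟩
    refine (mul_mk h).trans ?_
    simp only [PreGerm.mul, PreGerm.inv, mul_inv_cancel]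
    exact mk_unit p.v (p.g • p.ξ)
  mul_assoc := mul_assoc

/-- The topology of germs: a basis is given by the sets `{[s, ρ] : ρ ∈ U}`, where
`s = s_v u_g s_w^*` and `U` is an open subset of the domain of `s`. -/
instance : TopologicalSpace (Germ G X) :=
  TopologicalSpace.generateFrom
    {V | ∃ (v : List X) (g : G) (w : List X) (U : Set (Stream' X)), IsOpen U ∧
      V = {γ | ∃ ξ : Stream' X, w ++ₛ ξ ∈ U ∧ γ = mk ⟨v, g, w, ξ⟩}}

end

end Germ

/-- The subgroupoid `𝒢(G, X)_0` of germs of degree zero, with the subspace topology. -/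
def GermZero (G X : Type*) [Group G] [MulAction G (Stream' X)] [IsSelfSimilar G X] : Type _ :=
  {γ : Germ G X // γ.deg = 0}

section Nucleus

variable (G X : Type*) [Group G] [MulAction G (Stream' X)] [IsSelfSimilar G X]

instance : TopologicalSpace (GermZero G X) :=
  inferInstanceAs (TopologicalSpace {γ : Germ G X // γ.deg = 0})

instance [FaithfulSMul G (Stream' X)] : ArrowGroupoid (GermZero G X) (Stream' X) where
  src a := ArrowGroupoid.src a.1
  tgt a := ArrowGroupoid.tgt a.1
  unit x := ⟨ArrowGroupoid.unit x, rfl⟩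
  inv a := ⟨ArrowGroupoid.inv a.1, (Germ.deg_inv a.1).trans (by rw [a.2, neg_zero])⟩
  mul a b h := ⟨ArrowGroupoid.mul a.1 b.1 h,
    (Germ.deg_mul a.1 b.1 h).trans (by rw [a.2, b.2, add_zero])⟩
  src_unit x := ArrowGroupoid.src_unit x
  tgt_unit x := ArrowGroupoid.tgt_unit x
  src_inv a := ArrowGroupoid.src_inv a.1
  tgt_inv a := ArrowGroupoid.tgt_inv a.1
  src_mul a b h := ArrowGroupoid.src_mul a.1 b.1 h
  tgt_mul a b h := ArrowGroupoid.tgt_mul a.1 b.1 h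
  unit_mul a := Subtype.ext (ArrowGroupoid.unit_mul a.1)
  mul_unit a := Subtype.ext (ArrowGroupoid.mul_unit a.1)
  inv_mul a := Subtype.ext (ArrowGroupoid.inv_mul a.1)
  mul_inv a := Subtype.ext (ArrowGroupoid.mul_inv a.1)
  mul_assoc a b c h₁ h₂ := Subtype.ext (ArrowGroupoid.mul_assoc a.1 b.1 c.1 h₁ h₂)

variable {G} in
/-- The element `u_g` of the groupoid algebra of `𝒢(G, X)`: the indicator function of the set of
all germs of the transformation `g` of `X^ω`. -/
def unitaryElement (g : G) : Germ G X → ℂ :=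
  {γ : Germ G X | ∃ ξ : Stream' X, γ = Germ.mk ⟨[], g, [], ξ⟩}.indicator 1

/-- `ℂ𝒩` as a subspace of the algebra of `𝒢(G, X)`: the span of the elements `u_g`, for `g` in
the nucleus. -/
def nucleusSpan : Submodule ℂ (Germ G X → ℂ) :=
  Submodule.span ℂ (unitaryElement X '' nucleus G X)

/-- `ℂ𝒩` as a subspace of the algebra of `𝒢(G, X)_0`: the restrictions to `𝒢(G, X)_0` of the
functions in `nucleusSpan`, which all vanish outside of `𝒢(G, X)_0`. -/
def nucleusSpanZero : Submodule ℂ (GermZero G X → ℂ) :=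
  Submodule.span ℂ ((fun g : G => fun γ : GermZero G X => unitaryElement X g γ.1) '' nucleus G X)

end Nucleus

end SelfSimilar

end

/-!
The groupoid `𝒢(G, X)` is covered by the charts `ξ ↦ [s_v u_g s_w^*, w ξ]`, whose images, the slices,
are compact open bisections. The maps `translate v g w : γ ↦ s_v u_g γ s_w^*` are open embeddings of
the set of germs into itself, and convolution by the indicator function of a slice moves functions
along such maps (`conv_slice_left`, `conv_slice_conv_slice`).

For a function `f` and finite words `v`, `w` let `block v w f` be the part of degree zero of
`s_v^* f s_w`, and `unblock v w h = s_v h s_w^*`. An element `f` of the algebra is, for every large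
`n`, the sum of the finitely many functions `unblock v w (block v w f)` with `|w| = n`
(`mem_of_unblock_block_mem`), and contraction says that all of these blocks are in `ℂ𝒩` when `n` is
large (`exists_block_mem_span`). Since translations are open embeddings, the blocks in `ℂ𝒩` of an
element of the essential ideal are again in the essential ideal. As `s_v` and `s_w^*` are in the
algebra, this shows that the essential ideal of `𝒢(G, X)` is contained in the ideal generated by its
intersection with `ℂ𝒩`. Conversely, the essential ideal is an ideal: it is additive because the
support of each of its elements is nowhere dense (`exists_dense_eq_zero`), and stable under
multiplication because the algebra is spanned by the indicator functions of slices.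

For the subgroupoid of degree zero only the products `s_v s_{v'}^*` with `|v| = |v'|` are available.
Let `M` be the intersection of the essential ideal with `ℂ𝒩`, and `M_k` the span of the blocks of
elements of `M` at pairs of words of length `k`. These spaces decrease in `k`, and `M` has
finite dimension, so that `M_k = M_K` for all `k ≥ K` (`exists_blockSpan_stable`). If all blocks
of `f` at pairs of words of length `n` are in `M`, then its blocks at pairs `(V, W)` of words of
length `n + K` are in `M_K = M_{n + K}`, hence are linear combinations of functions `s_v^* h s_w` with
`h` in `M` and `|v| = |w| = n + K`. Now `s_V s_v^* h s_w s_W^*` is a product in the algebra of the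
subgroupoid (`unblock_mem_map_extendZero`). The algebra of the subgroupoid is identified throughout
with a subalgebra of that of `𝒢(G, X)` by extension by zero (`extendZero_conv`).
-/

set_option linter.unusedSectionVars false

noncomputable section

open scoped Stream'

/-! ### Algebras and essential ideals of topological groupoids -/

namespace ArrowGroupoid

section Convolution

variable {Γ Ob : Type*} [ArrowGroupoid Γ Ob]

theorem mul_congr {a a' b b' : Γ} (ha : a = a') (hb : b = b') (h : src a = tgt b)
    (h' : src a' = tgt b') : mul a b h = mul a' b' h' := by
  subst ha hb; rfl

theorem inv_mul_cancel_left (a b : Γ) (h : src a = tgt b) :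
    mul (inv a) (mul a b h) ((src_inv a).trans (tgt_mul a b h).symm) = b := by
  rw [← mul_assoc _ _ _ (src_inv a), mul_congr (inv_mul a) rfl _ ((src_unit _).trans h),
    mul_congr (congrArg unit h) rfl _ (src_unit _), unit_mul]

theorem mul_left_cancel {a b c : Γ} (h : src a = tgt b) (h' : src a = tgt c)
    (e : mul a b h = mul a c h') : b = c := by
  rw [← inv_mul_cancel_left a b h, ← inv_mul_cancel_left a c h']
  exact mul_congr rfl e _ _

theorem eq_inv_of_mul_eq_unit {a b : Γ} (h : src a = tgt b) (e : mul a b h = unit (tgt a)) :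
    b = inv a := by
  refine mul_left_cancel h (tgt_inv a).symm ?_
  rw [e, mul_inv]

theorem inv_inv (a : Γ) : inv (inv a) = a := by
  refine (eq_inv_of_mul_eq_unit (src_inv a) ?_).symm
  rw [inv_mul, tgt_inv]

theorem inv_involutive : Function.Involutive (inv : Γ → Γ) := inv_inv

theorem inv_mul_rev (a b : Γ) (h : src a = tgt b) :
    inv (mul a b h) = mul (inv b) (inv a) ((src_inv b).trans (h.symm.trans (tgt_inv a).symm)) := by
  have h₁ : src b = tgt (inv b) := (tgt_inv b).symm
  have h₂ : src (inv b) = tgt (inv a) := (src_inv b).trans (h.symm.trans (tgt_inv a).symm)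
  refine (eq_inv_of_mul_eq_unit ((src_mul a b h).trans (h₁.trans (tgt_mul _ _ h₂).symm)) ?_).symm
  have e : mul b (mul (inv b) (inv a) h₂) (h₁.trans (tgt_mul _ _ h₂).symm) = inv a := by
    rw [← mul_assoc _ _ _ h₁ h₂,
      mul_congr ((mul_inv b).trans (congrArg unit (h.symm.trans (tgt_inv a).symm))) rfl _
        (src_unit _), unit_mul]
  rw [mul_assoc a b _ h (h₁.trans (tgt_mul _ _ h₂).symm), mul_congr rfl e _ (tgt_inv a).symm,
    mul_inv, tgt_mul]

/-- Convolution by the indicator function of a set on which the range map is injective is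
translation by the element of this set that has the given range. -/
theorem conv_indicator_mul {F : Set Γ} (hF : F.InjOn tgt) (f : Γ → ℂ) {d γ : Γ} (hd : d ∈ F)
    (h : src d = tgt γ) : conv (F.indicator 1) f (mul d γ h) = f γ := by
  rw [conv, finsum_eq_single _ ⟨(d, γ), h, rfl⟩]
  · simp [hd]
  · rintro ⟨⟨a, b⟩, hab, e⟩ hne
    dsimp only at hab e ⊢
    by_cases ha : a ∈ F
    · have had : a = d := hF ha hd (by rw [← tgt_mul a b hab, e, tgt_mul])
      subst had
      exact (hne (Subtype.ext (Prod.ext rfl (mul_left_cancel hab h e)))).elim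
    · simp [ha]

theorem conv_indicator_eq_zero {F : Set Γ} (f : Γ → ℂ) {γ : Γ} (h : ∀ d ∈ F, tgt d ≠ tgt γ) :
    conv (F.indicator 1) f γ = 0 := by
  refine finsum_eq_zero_of_forall_eq_zero ?_
  rintro ⟨⟨a, b⟩, hab, e⟩
  dsimp only at hab e ⊢
  have ha : a ∉ F := fun ha => h a ha (by rw [← e, tgt_mul])
  simp [ha]

/-- The involution `f ↦ f ∘ inv` reverses convolution products. -/
theorem conv_comp_inv (f₁ f₂ : Γ → ℂ) :
    conv f₁ f₂ ∘ inv = conv (f₂ ∘ inv) (f₁ ∘ inv) := by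
  have key : ∀ {γ δ : Γ}, γ = inv δ → ∀ p : Γ × Γ, (∃ h : src p.1 = tgt p.2, mul p.1 p.2 h = γ) →
      ∃ h : src (inv p.2) = tgt (inv p.1), mul (inv p.2) (inv p.1) h = δ := by
    rintro γ δ hγ p ⟨h, e⟩
    refine ⟨(src_inv p.2).trans (h.symm.trans (tgt_inv p.1).symm), ?_⟩
    rw [← inv_mul_rev _ _ h, e, hγ, inv_inv]
  funext γ
  let φ : {p : Γ × Γ // ∃ h : src p.1 = tgt p.2, mul p.1 p.2 h = inv γ} ≃
      {p : Γ × Γ // ∃ h : src p.1 = tgt p.2, mul p.1 p.2 h = γ} :=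
    { toFun p := ⟨(inv p.1.2, inv p.1.1), key rfl p.1 p.2⟩
      invFun p := ⟨(inv p.1.2, inv p.1.1), key (inv_inv γ).symm p.1 p.2⟩
      left_inv p := Subtype.ext (Prod.ext (inv_inv _) (inv_inv _))
      right_inv p := Subtype.ext (Prod.ext (inv_inv _) (inv_inv _)) }
  refine finsum_eq_of_bijective φ φ.bijective fun p => ?_
  simp [φ, inv_inv, mul_comm]

theorem conv_eq_conv_comp_inv (f₁ f₂ : Γ → ℂ) :
    conv f₁ f₂ = conv (f₂ ∘ inv) (f₁ ∘ inv) ∘ inv := by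
  rw [conv_comp_inv]
  congr 1 <;> funext γ <;> simp [inv_inv]

end Convolution

section Topology

variable {Γ Ob : Type*} [ArrowGroupoid Γ Ob] [TopologicalSpace Γ] [TopologicalSpace Ob]

theorem IsBisection.injOn_src {F : Set Γ} (h : IsBisection F) : F.InjOn src :=
  Set.injOn_iff_injective.2 h.1.injective

theorem IsBisection.injOn_tgt {F : Set Γ} (h : IsBisection F) : F.InjOn tgt :=
  Set.injOn_iff_injective.2 h.2.injective

/-- A compact set is a bisection if the continuous source and range maps are injective on it. -/
theorem isBisection_of_injOn [T2Space Ob] (hs : Continuous (src : Γ → Ob))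
    (ht : Continuous (tgt : Γ → Ob)) {F : Set Γ} (hF : IsCompact F) (h₁ : F.InjOn src)
    (h₂ : F.InjOn tgt) : IsBisection F := by
  have : CompactSpace F := isCompact_iff_compactSpace.1 hF
  exact ⟨((hs.comp continuous_subtype_val).isClosedEmbedding
      (Set.injOn_iff_injective.1 h₁)).isEmbedding,
    ((ht.comp continuous_subtype_val).isClosedEmbedding
      (Set.injOn_iff_injective.1 h₂)).isEmbedding⟩

theorem indicator_mem_algebra {F : Set Γ} (hc : IsCompact F) (ho : IsOpen F)
    (hb : IsBisection F) : F.indicator 1 ∈ algebra Γ :=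
  Submodule.subset_span ⟨F, hc, ho, hb, rfl⟩

/-- An element of the algebra is nonzero at only finitely many arrows of given range. -/
theorem finite_support_inter_tgt {f : Γ → ℂ} (hf : f ∈ algebra Γ) (x : Ob) :
    {γ | f γ ≠ 0 ∧ tgt γ = x}.Finite := by
  induction hf using Submodule.span_induction with
  | mem f hf =>
    obtain ⟨F, -, -, hb, rfl⟩ := hf
    refine Set.Subsingleton.finite ?_
    rintro a ⟨ha, hax⟩ b ⟨hb', hbx⟩
    exact hb.injOn_tgt (Set.mem_of_indicator_ne_zero ha) (Set.mem_of_indicator_ne_zero hb')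
      (hax.trans hbx.symm)
  | zero => simp
  | add f g _ _ hf hg =>
    refine (hf.union hg).subset ?_
    rintro γ ⟨h, hx⟩
    by_cases h0 : f γ = 0
    · exact Or.inr ⟨fun h1 => h (by simp [h0, h1]), hx⟩
    · exact Or.inl ⟨h0, hx⟩
  | smul c f _ hf =>
    refine hf.subset ?_
    rintro γ ⟨h, hx⟩
    exact ⟨fun h0 => h (by simp [h0]), hx⟩

theorem finite_support_conv {a : Γ → ℂ} (ha : a ∈ algebra Γ) (f : Γ → ℂ) (γ : Γ) :
    Function.HasFiniteSupport
      (fun p : {p : Γ × Γ // ∃ h : src p.1 = tgt p.2, mul p.1 p.2 h = γ} =>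
        a p.1.1 * f p.1.2) := by
  refine Set.Finite.of_finite_image ((finite_support_inter_tgt ha (tgt γ)).subset ?_)
    (f := fun p => p.1.1) ?_
  · rintro _ ⟨⟨⟨b, c⟩, h, e⟩, hp, rfl⟩
    exact ⟨left_ne_zero_of_mul hp, (tgt_mul b c h).symm.trans (congrArg tgt e)⟩
  · rintro ⟨⟨b, c⟩, h, e⟩ _ ⟨⟨b', c'⟩, h', e'⟩ _ hbb
    dsimp only at h h' e e' hbb
    subst hbb
    exact Subtype.ext (Prod.ext rfl (mul_left_cancel h h' (e.trans e'.symm)))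

theorem conv_add_left {a b : Γ → ℂ} (ha : a ∈ algebra Γ) (hb : b ∈ algebra Γ) (f : Γ → ℂ) :
    conv (a + b) f = conv a f + conv b f := by
  funext γ
  simp only [conv, Pi.add_apply, add_mul]
  exact finsum_add_distrib (finite_support_conv ha f γ) (finite_support_conv hb f γ)

theorem conv_smul_left (c : ℂ) (a f : Γ → ℂ) :
    conv (c • a) f = c • conv a f := by
  funext γ
  simp only [conv, Pi.smul_apply, smul_eq_mul, _root_.mul_assoc]
  exact (mul_finsum _ c).symm

/-- Every element of the algebra is locally constant on a dense open set of arrows. -/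
theorem exists_dense_locally_constant {f : Γ → ℂ} (hf : f ∈ algebra Γ) :
    ∃ O : Set Γ, IsOpen O ∧ Dense O ∧ ∀ γ ∈ O, ∀ᶠ δ in nhds γ, f δ = f γ := by
  induction hf using Submodule.span_induction with
  | mem f hf =>
    obtain ⟨F, -, ho, -, rfl⟩ := hf
    refine ⟨F ∪ (closure F)ᶜ, ho.union isClosed_closure.isOpen_compl, ?_, ?_⟩
    · rw [dense_iff_closure_eq, closure_union, Set.eq_univ_iff_forall]
      intro γ
      by_cases h : γ ∈ closure F
      · exact Or.inl h
      · exact Or.inr (subset_closure h)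
    · rintro γ (h | h)
      · filter_upwards [ho.mem_nhds h] with δ hδ
        rw [Set.indicator_of_mem hδ, Set.indicator_of_mem h]; rfl
      · filter_upwards [isClosed_closure.isOpen_compl.mem_nhds h] with δ hδ
        rw [Set.indicator_of_notMem fun h' => hδ (subset_closure h'),
          Set.indicator_of_notMem fun h' => h (subset_closure h')]
  | zero => exact ⟨Set.univ, isOpen_univ, dense_univ, by simp⟩
  | add f g _ _ hf hg =>
    obtain ⟨O, ho, hd, h⟩ := hf
    obtain ⟨O', ho', hd', h'⟩ := hg
    refine ⟨O ∩ O', ho.inter ho', hd.inter_of_isOpen_left hd' ho, fun γ hγ => ?_⟩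
    filter_upwards [h γ hγ.1, h' γ hγ.2] with δ h1 h2
    simp [h1, h2]
  | smul c f _ hf =>
    obtain ⟨O, ho, hd, h⟩ := hf
    refine ⟨O, ho, hd, fun γ hγ => ?_⟩
    filter_upwards [h γ hγ] with δ h1
    simp [h1]

/-- An element of the essential ideal vanishes on a dense open set. In particular its support is
nowhere dense, and not merely of empty interior; this makes the essential ideal additive. -/
theorem exists_dense_eq_zero {f : Γ → ℂ} (hf : f ∈ essentialIdeal Γ) :
    ∃ O : Set Γ, IsOpen O ∧ Dense O ∧ ∀ γ ∈ O, f γ = 0 := by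
  obtain ⟨O, ho, hd, h⟩ := exists_dense_locally_constant hf.1
  refine ⟨O, ho, hd, fun γ hγ => by_contra fun h0 => ?_⟩
  have : γ ∈ interior (Function.support f) := by
    rw [mem_interior_iff_mem_nhds]
    filter_upwards [h γ hγ] with δ hδ
    rw [Function.mem_support, hδ]
    exact h0
  rw [hf.2] at this
  exact this

theorem interior_support_eq_empty {f : Γ → ℂ} {O : Set Γ} (hd : Dense O)
    (h : ∀ γ ∈ O, f γ = 0) : interior (Function.support f) = ∅ := by
  refine Set.subset_empty_iff.1 fun γ hγ => ?_
  obtain ⟨δ, hδ, hδO⟩ := hd.inter_open_nonempty _ isOpen_interior ⟨γ, hγ⟩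
  exact interior_subset hδ (h δ hδO)

variable (Γ) in
/-- The essential ideal as a linear subspace. -/
def essentialSubmodule : Submodule ℂ (Γ → ℂ) where
  carrier := essentialIdeal Γ
  zero_mem' := ⟨Submodule.zero_mem _, by simp⟩
  add_mem' {f g} hf hg := by
    obtain ⟨O, ho, hd, h⟩ := exists_dense_eq_zero hf
    obtain ⟨O', ho', hd', h'⟩ := exists_dense_eq_zero hg
    refine ⟨Submodule.add_mem _ hf.1 hg.1,
      interior_support_eq_empty (hd.inter_of_isOpen_left hd' ho) fun γ hγ => ?_⟩
    simp [h γ hγ.1, h' γ hγ.2]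
  smul_mem' c f hf := by
    obtain ⟨O, ho, hd, h⟩ := exists_dense_eq_zero hf
    refine ⟨Submodule.smul_mem _ c hf.1, interior_support_eq_empty hd fun γ hγ => ?_⟩
    simp [h γ hγ]

/-- If the essential ideal is stable under multiplication by the algebra, then every ideal
generated by some of its elements is contained in it. -/
theorem idealGeneratedBy_subset_essentialIdeal
    (h : ∀ a ∈ algebra Γ, ∀ f ∈ essentialIdeal Γ,
      conv a f ∈ essentialIdeal Γ ∧ conv f a ∈ essentialIdeal Γ)
    {S : Set (Γ → ℂ)} (hS : S ⊆ essentialIdeal Γ) :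
    (idealGeneratedBy Γ S : Set (Γ → ℂ)) ⊆ essentialIdeal Γ := by
  have : idealGeneratedBy Γ S ≤ essentialSubmodule Γ := sInf_le ⟨fun f hf => hf.1, hS, h⟩
  exact this

end Topology

end ArrowGroupoid

/-! ### The topology of infinite words -/

namespace SelfSimilar

section Words

variable {X : Type*}

theorem dist_le_iff_take_eq {ξ η : Stream' X} {n : ℕ} :
    dist η ξ ≤ (1 / 2) ^ n ↔ η.take n = ξ.take n := by
  let : TopologicalSpace X := ⊥
  have : DiscreteTopology X := ⟨rfl⟩
  refine (PiNat.mem_cylinder_iff_dist_le (E := fun _ => X) (x := ξ) (y := η) (n := n)).symm.trans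
    ⟨fun h => ?_, fun h i hi => ?_⟩
  · refine List.ext_getElem (by simp) fun i hi _ => ?_
    rw [Stream'.length_take] at hi
    exact (Stream'.take_get _ _ _ _).trans ((h i hi).trans (Stream'.take_get _ _ _ _).symm)
  · have := congrArg (fun l => l[i]?) h
    rw [Stream'.getElem?_take hi, Stream'.getElem?_take hi] at this
    exact Option.some.inj this

/-- A set of infinite words is open if and only if it contains, with each of its elements `ξ`, all
infinite words that share a certain prefix with `ξ`. -/
theorem isOpen_iff_prefix {U : Set (Stream' X)} :
    IsOpen U ↔ ∀ ξ ∈ U, ∃ n : ℕ, ∀ η : Stream' X, ξ.take n ++ₛ η ∈ U := by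
  rw [Metric.isOpen_iff]
  refine forall₂_congr fun ξ _ => ⟨?_, ?_⟩
  · rintro ⟨ε, hε, h⟩
    obtain ⟨n, hn⟩ := exists_pow_lt_of_lt_one hε (by norm_num : (1 / 2 : ℝ) < 1)
    refine ⟨n, fun η => h ((dist_le_iff_take_eq.2 ?_).trans_lt hn)⟩
    refine (PreGerm.append_stream_inj
      ((Stream'.append_take_drop n (ξ.take n ++ₛ η))) (by simp)).1
  · rintro ⟨n, h⟩
    refine ⟨(1 / 2) ^ n, by positivity, fun η hη => ?_⟩
    have := dist_le_iff_take_eq.1 (le_of_lt hη)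
    rw [← Stream'.append_take_drop n η, this]
    exact h _

theorem take_append (u : List X) (ξ : Stream' X) : (u ++ₛ ξ).take u.length = u :=
  (PreGerm.append_stream_inj (Stream'.append_take_drop u.length (u ++ₛ ξ)) (by simp)).1

theorem append_stream_injective (u : List X) : Function.Injective (u ++ₛ · : Stream' X → _) :=
  fun _ _ h => (PreGerm.append_stream_inj h rfl).2

theorem exists_append_of_le {u v : List X} {ξ η : Stream' X} (h : u ++ₛ ξ = v ++ₛ η)
    (hl : u.length ≤ v.length) : ∃ b : List X, v = u ++ b ∧ ξ = b ++ₛ η := by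
  have h' : u ++ₛ ξ = v.take u.length ++ₛ (v.drop u.length ++ₛ η) := by
    rw [← Stream'.append_append_stream, List.take_append_drop, h]
  obtain ⟨h1, h2⟩ := PreGerm.append_stream_inj h' (by simp [hl])
  refine ⟨v.drop u.length, ?_, h2⟩
  conv_lhs => rw [← List.take_append_drop u.length v, ← h1]

theorem continuous_append (u : List X) : Continuous (u ++ₛ · : Stream' X → _) := by
  refine ⟨fun U hU => isOpen_iff_prefix.2 fun ξ hξ => ?_⟩
  obtain ⟨n, hn⟩ := isOpen_iff_prefix.1 hU _ hξ
  refine ⟨n, fun η => ?_⟩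
  have h := hn (((u ++ₛ ξ).drop n).take u.length ++ₛ η)
  rwa [← Stream'.append_append_stream, ← Stream'.take_add, add_comm, ← Stream'.append_take,
    Stream'.append_append_stream] at h

theorem isOpenMap_append (u : List X) : IsOpenMap (u ++ₛ · : Stream' X → _) := by
  refine fun U hU => isOpen_iff_prefix.2 ?_
  rintro _ ⟨ξ, hξ, rfl⟩
  obtain ⟨n, hn⟩ := isOpen_iff_prefix.1 hU _ hξ
  refine ⟨(u ++ ξ.take n).length, fun η => ⟨ξ.take n ++ₛ η, hn η, ?_⟩⟩
  have : u ++ₛ ξ = (u ++ ξ.take n) ++ₛ ξ.drop n := by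
    rw [Stream'.append_append_stream, Stream'.append_take_drop]
  dsimp only
  rw [this, take_append, Stream'.append_append_stream]

instance [Finite X] : CompactSpace (Stream' X) := by
  let : TopologicalSpace X := ⊥
  have : DiscreteTopology X := ⟨rfl⟩
  exact inferInstanceAs (CompactSpace (ℕ → X))

theorem isClosed_range_append [Finite X] (u : List X) :
    IsClosed (Set.range (u ++ₛ · : Stream' X → _)) :=
  (isCompact_range (continuous_append u)).isClosed

end Words

end SelfSimilar

/-! ### The action on finite words -/

namespace SelfSimilar

section WordAction

variable {G X : Type*} [Group G] [MulAction G (Stream' X)] [IsSelfSimilar G X]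

/-- The finite word `g(u)`, of the same length as `u`. -/
def wordAct (g : G) : List X → List X
  | .nil => .nil
  | .cons x u => letter g x :: wordAct (sect g x) u

theorem length_wordAct (g : G) (u : List X) : (wordAct g u).length = u.length := by
  induction u generalizing g with
  | nil => rfl
  | cons x u ih => simp [wordAct, ih]

theorem smul_append (g : G) (u : List X) (ξ : Stream' X) :
    g • (u ++ₛ ξ) = wordAct g u ++ₛ (wordSect g u • ξ) := by
  induction u generalizing g with
  | nil => rfl
  | cons x u ih =>
    rw [Stream'.cons_append_stream, smul_cons, ih]
    rfl

theorem wordAct_append (g : G) (u v : List X) :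
    wordAct g (u ++ v) = wordAct g u ++ wordAct (wordSect g u) v := by
  induction u generalizing g with
  | nil => rfl
  | cons x u ih => simp [wordAct, wordSect, ih]

theorem wordAct_concat (g : G) (u : List X) (x : X) :
    wordAct g (u ++ [x]) = wordAct g u ++ [letter (wordSect g u) x] :=
  wordAct_append g u [x]

theorem wordSect_concat (g : G) (u : List X) (x : X) :
    wordSect g (u ++ [x]) = sect (wordSect g u) x := by
  rw [wordSect_append]; rfl

variable [FaithfulSMul G (Stream' X)]

theorem wordAct_one (u : List X) : wordAct (1 : G) u = u := by
  induction u with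
  | nil => rfl
  | cons x u ih => rw [wordAct, (letter_sect_one x).1, (letter_sect_one x).2, ih]

theorem wordSect_one (u : List X) : wordSect (1 : G) u = 1 := by
  induction u with
  | nil => rfl
  | cons x u ih => rw [wordSect, (letter_sect_one x).2, ih]

theorem wordAct_mul (g h : G) (u : List X) : wordAct (g * h) u = wordAct g (wordAct h u) := by
  induction u generalizing g h with
  | nil => rfl
  | cons x u ih => simp only [wordAct, (letter_sect_mul g h x).1, (letter_sect_mul g h x).2, ih]

theorem wordSect_mul (g h : G) (u : List X) :
    wordSect (g * h) u = wordSect g (wordAct h u) * wordSect h u := by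
  induction u generalizing g h with
  | nil => rfl
  | cons x u ih => simp only [wordAct, wordSect, (letter_sect_mul g h x).2, ih]

theorem wordAct_inv_wordAct (g : G) (u : List X) : wordAct g⁻¹ (wordAct g u) = u := by
  rw [← wordAct_mul, inv_mul_cancel, wordAct_one]

theorem wordAct_wordAct_inv (g : G) (u : List X) : wordAct g (wordAct g⁻¹ u) = u := by
  rw [← wordAct_mul, mul_inv_cancel, wordAct_one]

end WordAction

/-! ### Charts of the groupoid of germs -/

section Charts

variable {G X : Type*} [Group G] [MulAction G (Stream' X)] [IsSelfSimilar G X]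

namespace Germ

theorem iterate_step (p : PreGerm G X) (n : ℕ) :
    PreGerm.step^[n] p = ⟨p.v ++ wordAct p.g (p.ξ.take n), wordSect p.g (p.ξ.take n),
      p.w ++ p.ξ.take n, p.ξ.drop n⟩ := by
  induction n with
  | zero => simp [wordAct, wordSect]
  | succ n ih =>
    rw [Function.iterate_succ_apply', ih, PreGerm.step, Stream'.take_succ']
    simp only [wordAct_concat, wordSect_concat, List.append_assoc, Stream'.head_drop,
      Stream'.tail_drop, Stream'.drop_succ]

/-- The chart `ξ ↦ [s_v u_g s_w^*, w ξ]`. -/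
def chart (v : List X) (g : G) (w : List X) (ξ : Stream' X) : Germ G X := mk ⟨v, g, w, ξ⟩

theorem src_chart (v : List X) (g : G) (w : List X) (ξ : Stream' X) :
    src (chart v g w ξ) = w ++ₛ ξ := rfl

theorem tgt_chart (v : List X) (g : G) (w : List X) (ξ : Stream' X) :
    tgt (chart v g w ξ) = v ++ₛ (g • ξ) := rfl

theorem deg_chart (v : List X) (g : G) (w : List X) (ξ : Stream' X) :
    deg (chart v g w ξ) = v.length - w.length := rfl

theorem exists_chart (γ : Germ G X) : ∃ v g w ξ, chart v g w ξ = γ := by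
  obtain ⟨p, rfl⟩ := exists_mk γ
  exact ⟨p.v, p.g, p.w, p.ξ, rfl⟩

/-- Passing to the smaller domain `w u X^ω`. -/
theorem chart_append (v : List X) (g : G) (w u : List X) (ξ : Stream' X) :
    chart v g w (u ++ₛ ξ) = chart (v ++ wordAct g u) (wordSect g u) (w ++ u) ξ := by
  have h : (u ++ₛ ξ).drop u.length = ξ :=
    (PreGerm.append_stream_inj (Stream'.append_take_drop u.length (u ++ₛ ξ)) (by simp)).2
  have := PreGerm.iterate_equiv (⟨v, g, w, u ++ₛ ξ⟩ : PreGerm G X) u.length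
  rw [iterate_step] at this
  simp only [take_append, h] at this
  exact (mk_eq_mk.2 this).symm

theorem exists_of_chart_eq {v v' : List X} {g g' : G} {w w' : List X} {ξ ξ' : Stream' X}
    (h : chart v g w ξ = chart v' g' w' ξ') :
    ∃ (u u' : List X) (ζ : Stream' X), ξ = u ++ₛ ζ ∧ ξ' = u' ++ₛ ζ ∧ w ++ u = w' ++ u' ∧
      ∀ η : Stream' X, chart v g w (u ++ₛ η) = chart v' g' w' (u' ++ₛ η) := by
  obtain ⟨m, n, e⟩ := mk_eq_mk.1 h
  rw [iterate_step, iterate_step, PreGerm.mk.injEq] at e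
  dsimp only at e
  refine ⟨ξ.take m, ξ'.take n, ξ.drop m, (Stream'.append_take_drop _ _).symm, ?_, e.2.2.1, ?_⟩
  · rw [e.2.2.2, Stream'.append_take_drop]
  · intro η
    rw [chart_append, chart_append, e.1, e.2.1, e.2.2.1]

theorem chart_injective (v : List X) (g : G) (w : List X) :
    Function.Injective (chart v g w) := fun _ _ h =>
  append_stream_injective w (congrArg src h)

theorem isOpenMap_chart (v : List X) (g : G) (w : List X) : IsOpenMap (chart v g w) := by
  refine fun U hU => TopologicalSpace.isOpen_generateFrom_of_mem
    ⟨v, g, w, (w ++ₛ ·) '' U, isOpenMap_append w U hU, ?_⟩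
  ext γ
  constructor
  · rintro ⟨ξ, hξ, rfl⟩
    exact ⟨ξ, ⟨ξ, hξ, rfl⟩, rfl⟩
  · rintro ⟨ξ, ⟨η, hη, e⟩, rfl⟩
    exact ⟨ξ, append_stream_injective w e ▸ hη, rfl⟩

theorem continuous_chart (v : List X) (g : G) (w : List X) : Continuous (chart v g w) := by
  refine continuous_generateFrom_iff.2 ?_
  rintro _ ⟨v', g', w', U, hU, rfl⟩
  refine isOpen_iff_mem_nhds.2 ?_
  rintro ξ ⟨ξ', hξ', e⟩
  obtain ⟨u, u', ζ, rfl, rfl, hu, h⟩ := exists_of_chart_eq e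
  have ho := isOpenMap_append u _ (hU.preimage (continuous_append (w' ++ u')))
  refine Filter.mem_of_superset
    (ho.mem_nhds ⟨ζ, by simpa [Stream'.append_append_stream] using hξ', rfl⟩) ?_
  rintro _ ⟨η, hη, rfl⟩
  exact ⟨u' ++ₛ η, by simpa [Stream'.append_append_stream] using hη, h η⟩

theorem isOpenEmbedding_chart (v : List X) (g : G) (w : List X) :
    Topology.IsOpenEmbedding (chart v g w) :=
  .of_continuous_injective_isOpenMap (continuous_chart v g w) (chart_injective v g w)
    (isOpenMap_chart v g w)

theorem isOpen_iff_chart {U : Set (Germ G X)} :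
    IsOpen U ↔ ∀ v g w, IsOpen (chart v g w ⁻¹' U) := by
  refine ⟨fun h v g w => h.preimage (continuous_chart v g w), fun h => ?_⟩
  refine isOpen_iff_mem_nhds.2 fun γ hγ => ?_
  obtain ⟨v, g, w, ξ, rfl⟩ := exists_chart γ
  exact Filter.mem_of_superset ((isOpenMap_chart v g w _ (h v g w)).mem_nhds ⟨ξ, hγ, rfl⟩)
    (Set.image_preimage_subset _ _)

theorem continuous_of_chart {Y : Type*} [TopologicalSpace Y] {F : Germ G X → Y}
    (h : ∀ v g w, Continuous fun ξ => F (chart v g w ξ)) : Continuous F :=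
  ⟨fun _ hU => isOpen_iff_chart.2 fun v g w => hU.preimage (h v g w)⟩

theorem isOpenMap_of_chart {Y : Type*} [TopologicalSpace Y] {F : Germ G X → Y}
    (h : ∀ v g w, IsOpenMap fun ξ => F (chart v g w ξ)) : IsOpenMap F := by
  intro U hU
  have : F '' U = ⋃ (v) (g) (w), (fun ξ => F (chart v g w ξ)) '' (chart v g w ⁻¹' U) := by
    ext y
    simp only [Set.mem_iUnion]
    constructor
    · rintro ⟨γ, hγ, rfl⟩
      obtain ⟨v, g, w, ξ, rfl⟩ := exists_chart γ
      exact ⟨v, g, w, ξ, hγ, rfl⟩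
    · rintro ⟨v, g, w, ξ, hξ, rfl⟩
      exact ⟨_, hξ, rfl⟩
  rw [this]
  exact isOpen_iUnion fun v => isOpen_iUnion fun g => isOpen_iUnion fun w =>
    h v g w _ (hU.preimage (continuous_chart v g w))

/-- The compact open bisection `{[s_v u_g s_w^*, w ξ] : ξ ∈ X^ω}`. -/
def slice (v : List X) (g : G) (w : List X) : Set (Germ G X) := Set.range (chart v g w)

theorem isOpen_slice (v : List X) (g : G) (w : List X) : IsOpen (slice v g w) :=
  (isOpenEmbedding_chart v g w).isOpen_range

theorem isCompact_slice [Finite X] (v : List X) (g : G) (w : List X) : IsCompact (slice v g w) :=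
  isCompact_range (continuous_chart v g w)

theorem injOn_src_slice (v : List X) (g : G) (w : List X) : (slice v g w).InjOn src := by
  rintro _ ⟨ξ, rfl⟩ _ ⟨η, rfl⟩ h
  exact congrArg _ (append_stream_injective w h)

theorem injOn_tgt_slice (v : List X) (g : G) (w : List X) : (slice v g w).InjOn tgt := by
  rintro _ ⟨ξ, rfl⟩ _ ⟨η, rfl⟩ h
  exact congrArg _ (MulAction.injective g (append_stream_injective v h))

theorem slice_append_subset (v : List X) (g : G) (w u : List X) :
    slice (v ++ wordAct g u) (wordSect g u) (w ++ u) ⊆ slice v g w := by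
  rintro _ ⟨ξ, rfl⟩
  exact ⟨u ++ₛ ξ, chart_append v g w u ξ⟩

/-- Slices, with arbitrarily long words, form a neighbourhood basis. -/
theorem exists_slice_subset {U : Set (Germ G X)} (hU : IsOpen U) {v : List X} {g : G} {w : List X}
    {ξ : Stream' X} (h : chart v g w ξ ∈ U) :
    ∃ n, ∀ m, n ≤ m → slice (v ++ wordAct g (ξ.take m)) (wordSect g (ξ.take m)) (w ++ ξ.take m) ⊆
      U := by
  obtain ⟨n, hn⟩ := isOpen_iff_prefix.1 (hU.preimage (continuous_chart v g w)) ξ h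
  refine ⟨n, fun m hm => ?_⟩
  rintro _ ⟨η, rfl⟩
  rw [← chart_append]
  obtain ⟨k, rfl⟩ := Nat.exists_eq_add_of_le hm
  rw [Stream'.take_add, Stream'.append_append_stream]
  exact hn _

theorem mem_slice_take (v : List X) (g : G) (w : List X) (ξ : Stream' X) (m : ℕ) :
    chart v g w ξ ∈
      slice (v ++ wordAct g (ξ.take m)) (wordSect g (ξ.take m)) (w ++ ξ.take m) :=
  ⟨ξ.drop m, by rw [← chart_append, Stream'.append_take_drop]⟩

theorem continuous_src : Continuous (src : Germ G X → Stream' X) :=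
  continuous_of_chart fun _ _ w => continuous_append w

theorem continuous_deg : Continuous (deg : Germ G X → ℤ) :=
  continuous_of_chart fun v _ w => continuous_const (y := (v.length - w.length : ℤ))

variable [IsIsometricSMul G (Stream' X)]

theorem continuous_tgt : Continuous (tgt : Germ G X → Stream' X) :=
  continuous_of_chart fun v g _ => (continuous_append v).comp (isometry_smul _ g).continuous

variable [FaithfulSMul G (Stream' X)]

theorem continuous_inv : Continuous (inv : Germ G X → Germ G X) :=
  continuous_of_chart fun v g w =>
    (continuous_chart w g⁻¹ v).comp (isometry_smul _ g).continuous

theorem inv_preimage_slice (v : List X) (g : G) (w : List X) :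
    inv ⁻¹' slice v g w = slice w g⁻¹ v := by
  have key : ∀ (v : List X) (g : G) (w : List X) (γ), γ ∈ slice v g w →
      inv γ ∈ slice w g⁻¹ v := by
    rintro v g w _ ⟨ξ, rfl⟩
    exact ⟨g • ξ, rfl⟩
  ext γ
  refine ⟨fun h => ?_, fun h => ?_⟩
  · simpa only [show inv (inv γ) = γ from ArrowGroupoid.inv_inv γ] using key v g w _ h
  · have := key w g⁻¹ v γ h
    rwa [_root_.inv_inv] at this

theorem isBisection_of_injOn {F : Set (Germ G X)} (hF : IsCompact F) (h₁ : F.InjOn src)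
    (h₂ : F.InjOn tgt) : ArrowGroupoid.IsBisection F :=
  ArrowGroupoid.isBisection_of_injOn continuous_src continuous_tgt hF h₁ h₂

theorem slice_mem_algebra [Finite X] (v : List X) (g : G) (w : List X) :
    (slice v g w).indicator 1 ∈ ArrowGroupoid.algebra (Germ G X) :=
  ArrowGroupoid.indicator_mem_algebra (isCompact_slice v g w) (isOpen_slice v g w)
    (isBisection_of_injOn (isCompact_slice v g w) (injOn_src_slice v g w)
      (injOn_tgt_slice v g w))

end Germ

end Charts

end SelfSimilar

namespace SelfSimilar

/-! ### Translations of the groupoid of germs -/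

namespace Germ

section Translate

variable {G X : Type*} [Group G] [MulAction G (Stream' X)] [IsSelfSimilar G X]
  [FaithfulSMul G (Stream' X)]

/-- The action of `translate` on representatives. -/
def preTranslate (v : List X) (g : G) (w : List X) (p : PreGerm G X) : PreGerm G X :=
  ⟨v ++ wordAct g p.v, wordSect g p.v * p.g, w ++ p.w, p.ξ⟩

theorem preTranslate_step (v : List X) (g : G) (w : List X) (p : PreGerm G X) :
    preTranslate v g w (PreGerm.step p) = PreGerm.step (preTranslate v g w p) := by
  simp only [preTranslate, PreGerm.step, wordAct_concat, wordSect_concat, List.append_assoc,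
    (letter_sect_mul _ _ _).1, (letter_sect_mul _ _ _).2]

theorem preTranslate_iterate (v : List X) (g : G) (w : List X) (p : PreGerm G X) (n : ℕ) :
    preTranslate v g w (PreGerm.step^[n] p) = PreGerm.step^[n] (preTranslate v g w p) :=
  (Function.Semiconj.iterate_right (f := preTranslate v g w)
    (preTranslate_step v g w) n).eq p

/-- The map `γ ↦ s_v u_g γ s_w^*` of the set of germs to itself. -/
def translate (v : List X) (g : G) (w : List X) : Germ G X → Germ G X :=
  Quotient.map (preTranslate v g w) fun p q ⟨m, n, h⟩ =>
    ⟨m, n, by rw [← preTranslate_iterate, h, preTranslate_iterate]⟩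

theorem translate_chart (v : List X) (g : G) (w a : List X) (h : G) (b : List X)
    (ξ : Stream' X) : translate v g w (chart a h b ξ) =
      chart (v ++ wordAct g a) (wordSect g a * h) (w ++ b) ξ := rfl

theorem translate_one_chart (v w a : List X) (h : G) (b : List X) (ξ : Stream' X) :
    translate v 1 w (chart a h b ξ) = chart (v ++ a) h (w ++ b) ξ := by
  rw [translate_chart, wordAct_one, wordSect_one, one_mul]

theorem src_translate (v : List X) (g : G) (w : List X) (γ : Germ G X) :
    src (translate v g w γ) = w ++ₛ src γ := by
  obtain ⟨a, h, b, ξ, rfl⟩ := exists_chart γ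
  exact Stream'.append_append_stream _ _ _

theorem tgt_translate (v : List X) (g : G) (w : List X) (γ : Germ G X) :
    tgt (translate v g w γ) = v ++ₛ (g • tgt γ) := by
  obtain ⟨a, h, b, ξ, rfl⟩ := exists_chart γ
  rw [translate_chart, tgt_chart, tgt_chart, Stream'.append_append_stream, smul_append, mul_smul]

theorem deg_translate (v : List X) (g : G) (w : List X) (γ : Germ G X) :
    deg (translate v g w γ) = deg γ + v.length - w.length := by
  obtain ⟨a, h, b, ξ, rfl⟩ := exists_chart γ
  rw [translate_chart, deg_chart, deg_chart, List.length_append, List.length_append,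
    length_wordAct]
  push_cast
  ring

theorem translate_translate (v v' : List X) (g g' : G) (w w' : List X) (γ : Germ G X) :
    translate v g w (translate v' g' w' γ) =
      translate (v ++ wordAct g v') (wordSect g v' * g') (w ++ w') γ := by
  obtain ⟨a, h, b, ξ, rfl⟩ := exists_chart γ
  simp only [translate_chart, wordAct_append, wordSect_append, wordAct_mul, wordSect_mul,
    List.append_assoc, _root_.mul_assoc]

theorem translate_one_translate_one (v v' w w' : List X) (γ : Germ G X) :
    translate v 1 w (translate v' 1 w' γ) = translate (v ++ v') 1 (w ++ w') γ := by
  rw [translate_translate, wordAct_one, wordSect_one, one_mul]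

theorem translate_nil (γ : Germ G X) : translate [] 1 [] γ = γ := by
  obtain ⟨a, h, b, ξ, rfl⟩ := exists_chart γ
  exact translate_one_chart [] [] a h b ξ

theorem translate_injective (v : List X) (g : G) (w : List X) :
    Function.Injective (translate v g w) := by
  intro γ δ h
  obtain ⟨p, rfl⟩ := exists_mk γ
  obtain ⟨q, rfl⟩ := exists_mk δ
  obtain ⟨m, n, e⟩ := mk_eq_mk.1 h
  refine mk_eq_mk.2 ⟨m, n, ?_⟩
  rw [← preTranslate_iterate, ← preTranslate_iterate] at e
  generalize PreGerm.step^[m] p = p' at *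
  generalize PreGerm.step^[n] q = q' at *
  obtain ⟨a, x, b, ξ⟩ := p'
  obtain ⟨a', x', b', ξ'⟩ := q'
  simp only [preTranslate, PreGerm.mk.injEq, List.append_cancel_left_eq] at e ⊢
  obtain ⟨e1, e2, e3, e4⟩ := e
  have ha : a = a' := by
    rw [← wordAct_inv_wordAct g a, e1, wordAct_inv_wordAct]
  subst ha
  exact ⟨rfl, _root_.mul_left_cancel e2, e3, e4⟩

theorem mem_range_translate {v : List X} {g : G} {w : List X} {γ : Germ G X} :
    γ ∈ Set.range (translate v g w) ↔
      tgt γ ∈ Set.range (v ++ₛ · : Stream' X → _) ∧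
        src γ ∈ Set.range (w ++ₛ · : Stream' X → _) := by
  constructor
  · rintro ⟨δ, rfl⟩
    exact ⟨⟨_, (tgt_translate v g w δ).symm⟩, ⟨_, (src_translate v g w δ).symm⟩⟩
  · obtain ⟨a, h, b, ξ, rfl⟩ := exists_chart γ
    rw [← Stream'.append_take_drop (v.length + w.length) ξ, chart_append]
    rintro ⟨⟨η, hη⟩, ⟨ζ, hζ⟩⟩
    rw [tgt_chart] at hη
    rw [src_chart] at hζ
    obtain ⟨a', ha, -⟩ := exists_append_of_le hη (by
      rw [List.length_append, length_wordAct, Stream'.length_take]; omega)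
    obtain ⟨b', hb, -⟩ := exists_append_of_le hζ (by simp; omega)
    rw [ha, hb]
    refine ⟨chart (wordAct g⁻¹ a') (wordSect g⁻¹ a' * wordSect h (ξ.take (v.length + w.length))) b'
      (ξ.drop (v.length + w.length)), ?_⟩
    rw [translate_chart, wordAct_wordAct_inv g a', ← _root_.mul_assoc, ← wordSect_mul, mul_inv_cancel,
      wordSect_one, one_mul]

theorem continuous_translate (v : List X) (g : G) (w : List X) :
    Continuous (translate v g w) :=
  continuous_of_chart fun a h b =>
    continuous_chart (v ++ wordAct g a) (wordSect g a * h) (w ++ b)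

theorem isOpenEmbedding_translate (v : List X) (g : G) (w : List X) :
    Topology.IsOpenEmbedding (translate v g w) :=
  .of_continuous_injective_isOpenMap (continuous_translate v g w) (translate_injective v g w)
    (isOpenMap_of_chart fun a h b =>
      isOpenMap_chart (v ++ wordAct g a) (wordSect g a * h) (w ++ b))

theorem isClosedEmbedding_translate [Finite X] [IsIsometricSMul G (Stream' X)] (v : List X)
    (g : G) (w : List X) : Topology.IsClosedEmbedding (translate v g w) := by
  refine ⟨(isOpenEmbedding_translate v g w).isEmbedding, ?_⟩
  have : Set.range (translate v g w) =
      tgt ⁻¹' Set.range (v ++ₛ · : Stream' X → _) ∩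
        src ⁻¹' Set.range (w ++ₛ · : Stream' X → _) := by
    ext γ
    exact mem_range_translate
  rw [this]
  exact ((isClosed_range_append v).preimage continuous_tgt).inter
    ((isClosed_range_append w).preimage continuous_src)

theorem translate_mem_slice_iff {v w : List X} {g : G} {γ : Germ G X} :
    translate v 1 w γ ∈ slice v g w ↔ γ ∈ slice [] g [] := by
  have h : ∀ ξ : Stream' X, translate v 1 w (chart [] g [] ξ) = chart v g w ξ := fun ξ => by
    rw [translate_one_chart, List.append_nil, List.append_nil]
  constructor
  · rintro ⟨ξ, e⟩
    exact ⟨ξ, translate_injective v 1 w ((h ξ).trans e)⟩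
  · rintro ⟨ξ, rfl⟩
    exact ⟨ξ, (h ξ).symm⟩

theorem slice_subset_range_translate (v : List X) (g : G) (w : List X) :
    slice v g w ⊆ Set.range (translate (G := G) v 1 w) := by
  rintro _ ⟨ξ, rfl⟩
  exact ⟨chart [] g [] ξ, by rw [translate_one_chart, List.append_nil, List.append_nil]⟩

theorem inv_translate_one (v w : List X) (γ : Germ G X) :
    inv (translate v 1 w γ) = translate w 1 v (inv γ) := by
  obtain ⟨a, h, b, ξ, rfl⟩ := exists_chart γ
  change _ = translate w 1 v (chart b h⁻¹ a (h • ξ))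
  rw [translate_one_chart, translate_one_chart]
  rfl

open ArrowGroupoid (conv)

/-- `s_v u_g s_w^* · s_w γ = s_v u_g γ`. -/
theorem conv_slice_translate (v : List X) (g : G) (w : List X) (f : Germ G X → ℂ)
    (γ : Germ G X) :
    conv ((slice v g w).indicator 1) f (translate v g [] γ) = f (translate w 1 [] γ) := by
  obtain ⟨a, h, b, ξ, rfl⟩ := exists_chart γ
  have hal : PreGerm.Aligned (⟨v ++ wordAct g a, wordSect g a, w ++ a, h • ξ⟩ : PreGerm G X)
      ⟨w ++ a, h, b, ξ⟩ := ⟨rfl, rfl⟩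
  have := ArrowGroupoid.conv_indicator_mul (injOn_tgt_slice v g w) f
    (γ := chart (w ++ a) h b ξ) (slice_append_subset v g w a ⟨h • ξ, rfl⟩) hal.src_eq
  rw [translate_one_chart, List.nil_append, ← this]
  exact congrArg _ (mul_mk hal).symm

theorem conv_slice_left (v : List X) (g : G) (w : List X) (f : Germ G X → ℂ) :
    conv ((slice v g w).indicator 1) f =
      Function.extend (translate v g []) (f ∘ translate w 1 []) 0 := by
  funext γ
  by_cases hγ : γ ∈ Set.range (translate v g [])
  · obtain ⟨δ, rfl⟩ := hγ
    rw [(translate_injective v g []).extend_apply, conv_slice_translate, Function.comp_apply]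
  · rw [Function.extend_apply' _ _ _ hγ]
    refine ArrowGroupoid.conv_indicator_eq_zero f ?_
    rintro _ ⟨ξ, rfl⟩ e
    exact hγ (mem_range_translate.2 ⟨⟨_, e⟩, ⟨_, rfl⟩⟩)

variable [IsIsometricSMul G (Stream' X)]

theorem conv_slice_right (v w : List X) (f : Germ G X → ℂ) :
    conv f ((slice v 1 w).indicator 1) =
      Function.extend (translate [] 1 w) (f ∘ translate [] 1 v) 0 := by
  have hs : (slice v (1 : G) w).indicator (1 : Germ G X → ℂ) ∘ inv =
      (slice w (1 : G) v).indicator 1 := by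
    have := inv_preimage_slice v (1 : G) w
    rw [inv_one] at this
    rw [← this]
    rfl
  have e : ∀ (u : List X) (γ : Germ G X), inv (translate u 1 [] (inv γ)) = translate [] 1 u γ :=
    fun u γ => by
      rw [inv_translate_one]
      exact congrArg _ (ArrowGroupoid.inv_inv γ)
  rw [ArrowGroupoid.conv_eq_conv_comp_inv]
  change conv ((slice v (1 : G) w).indicator (1 : Germ G X → ℂ) ∘ inv) _ ∘ inv = _
  rw [hs, conv_slice_left]
  funext γ
  rw [Function.comp_apply]
  by_cases hγ : γ ∈ Set.range (translate [] 1 w)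
  · obtain ⟨δ, rfl⟩ := hγ
    rw [(translate_injective [] 1 w).extend_apply]
    change Function.extend _ _ _ (inv (translate [] 1 w δ)) = _
    rw [inv_translate_one, (translate_injective w 1 []).extend_apply]
    exact congrArg f (e v δ)
  · rw [Function.extend_apply' _ _ _ hγ, Function.extend_apply']
    · rfl
    · rintro ⟨δ, hδ⟩
      refine hγ ⟨inv δ, ?_⟩
      rw [← inv_translate_one, hδ]
      exact ArrowGroupoid.inv_inv γ

/-- Two-sided multiplication by `s_v s_{v'}^*` and `s_{w'} s_w^*`. -/
theorem conv_slice_conv_slice (v v' w w' : List X) (f : Germ G X → ℂ) :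
    conv ((slice v 1 v').indicator 1) (conv f ((slice w' 1 w).indicator 1)) =
      Function.extend (translate v 1 w) (f ∘ translate v' 1 w') 0 := by
  have h : ∀ (v w : List X) (γ : Germ G X),
      translate v 1 [] (translate [] 1 w γ) = translate v 1 w γ := fun v w γ => by
    rw [translate_one_translate_one, List.append_nil, List.nil_append]
  have h' : ∀ (v w : List X) (γ : Germ G X),
      translate [] 1 w (translate v 1 [] γ) = translate v 1 w γ := fun v w γ => by
    rw [translate_one_translate_one, List.append_nil, List.nil_append]
  rw [conv_slice_left, conv_slice_right]
  funext γ
  by_cases hγ : γ ∈ Set.range (translate v 1 w)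
  · obtain ⟨δ, rfl⟩ := hγ
    rw [(translate_injective v 1 w).extend_apply, ← h, (translate_injective v 1 []).extend_apply,
      Function.comp_apply, h, ← h', (translate_injective [] 1 w).extend_apply,
      Function.comp_apply, h', Function.comp_apply]
  · rw [Function.extend_apply' _ _ _ hγ]
    by_cases hv : γ ∈ Set.range (translate v 1 [])
    · obtain ⟨δ, rfl⟩ := hv
      rw [(translate_injective v 1 []).extend_apply, Function.comp_apply, Function.extend_apply']
      · rfl
      · intro hδ
        have hδ' := (mem_range_translate.1 hδ).2
        rw [src_translate] at hδ'
        refine hγ (mem_range_translate.2 ⟨⟨_, (tgt_translate _ _ _ _).symm⟩, ?_⟩)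
        rw [src_translate]
        exact hδ'
    · rw [Function.extend_apply' _ _ _ hv]

end Translate

end Germ

end SelfSimilar

/-! ### Extension by zero along open embeddings -/

theorem support_extend_zero_eq_image {α β : Type*} {i : α → β} (hi : Function.Injective i)
    (f : α → ℂ) : Function.support (Function.extend i f 0) = i '' Function.support f := by
  ext b
  by_cases hb : b ∈ Set.range i
  · obtain ⟨a, rfl⟩ := hb
    rw [Function.mem_support, hi.extend_apply, hi.mem_set_image, Function.mem_support]
  · rw [Function.mem_support, Function.extend_apply' _ _ _ hb]
    exact iff_of_false (fun h => h rfl) fun ⟨a, _, h⟩ => hb ⟨a, h⟩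

theorem extend_indicator_zero {α β : Type*} {i : α → β} (hi : Function.Injective i) (F : Set α) :
    Function.extend i (F.indicator (1 : α → ℂ)) 0 = (i '' F).indicator 1 := by
  funext b
  by_cases hb : b ∈ Set.range i
  · obtain ⟨a, rfl⟩ := hb
    rw [hi.extend_apply]
    by_cases ha : a ∈ F
    · rw [Set.indicator_of_mem ha, Set.indicator_of_mem (Set.mem_image_of_mem i ha)]; rfl
    · rw [Set.indicator_of_notMem ha, Set.indicator_of_notMem (mt (hi.mem_set_image).1 ha)]
  · have hb' : b ∉ i '' F := fun ⟨a, _, h⟩ => hb ⟨a, h⟩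
    rw [Function.extend_apply' _ _ _ hb, Set.indicator_of_notMem hb']
    rfl

theorem interior_image_eq_empty {α β : Type*} [TopologicalSpace α] [TopologicalSpace β]
    {i : α → β} (hi : Topology.IsOpenEmbedding i) {S : Set α} :
    interior (i '' S) = ∅ ↔ interior S = ∅ := by
  constructor
  · intro h
    have := hi.isOpenMap.image_interior_subset S
    rw [h] at this
    exact Set.image_eq_empty.1 (Set.subset_empty_iff.1 this)
  · intro h
    rw [← Set.preimage_image_eq S hi.injective,
      ← hi.isOpenMap.preimage_interior_eq_interior_preimage hi.continuous,
      Set.preimage_eq_empty_iff] at h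
    have h' : interior (i '' S) ⊆ Set.range i := interior_subset.trans (Set.image_subset_range i S)
    exact disjoint_self.1 (h.mono_right h')

namespace SelfSimilar

namespace Germ

section

variable {G X : Type*} [Group G] [MulAction G (Stream' X)] [IsSelfSimilar G X]

/-! ### Decomposition of functions into blocks -/

theorem unitaryElement_eq (g : G) : unitaryElement X g = (slice [] g []).indicator 1 := by
  unfold unitaryElement slice
  congr 1
  ext γ
  exact exists_congr fun ξ => eq_comm

variable [FaithfulSMul G (Stream' X)]

/-- The part of degree zero of `s_v^* f s_w`. -/
def block (v w : List X) : (Germ G X → ℂ) →ₗ[ℂ] (Germ G X → ℂ) where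
  toFun f := {γ : Germ G X | deg γ = 0}.indicator (f ∘ translate v 1 w)
  map_add' _ _ := Set.indicator_add _ _ _
  map_smul' c _ := Set.indicator_const_smul _ c _

/-- `h ↦ s_v h s_w^*`: a function is moved along `translate v 1 w` and extended by zero. -/
def unblock (v w : List X) : (Germ G X → ℂ) →ₗ[ℂ] (Germ G X → ℂ) :=
  Function.ExtendByZero.linearMap ℂ (translate v 1 w)

theorem unblock_apply (v w : List X) (f : Germ G X → ℂ) :
    unblock v w f = Function.extend (translate v 1 w) f 0 := rfl

theorem block_apply (v w : List X) (f : Germ G X → ℂ) {γ : Germ G X} (h : deg γ = 0) :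
    block v w f γ = f (translate v 1 w γ) :=
  Set.indicator_of_mem (s := {γ : Germ G X | deg γ = 0}) h _

theorem block_apply_of_ne (v w : List X) (f : Germ G X → ℂ) {γ : Germ G X} (h : deg γ ≠ 0) :
    block v w f γ = 0 :=
  Set.indicator_of_notMem (s := {γ : Germ G X | deg γ = 0}) h _

theorem unblock_unitaryElement (v : List X) (g : G) (w : List X) :
    unblock v w (unitaryElement X g) = (slice v g w).indicator 1 := by
  rw [unitaryElement_eq, unblock_apply, extend_indicator_zero (translate_injective v 1 w)]
  congr 1
  ext γ
  constructor
  · rintro ⟨δ, hδ, rfl⟩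
    exact translate_mem_slice_iff.2 hδ
  · intro h
    obtain ⟨δ, rfl⟩ := slice_subset_range_translate v g w h
    exact ⟨δ, translate_mem_slice_iff.1 h, rfl⟩

/-- The function `s_v (s_v^* f s_w)_0 s_w^*` is the restriction of `f` to the germs in `range
(translate v 1 w)` of degree `|v| - |w|`. -/
theorem unblock_block_apply {v w : List X} {γ : Germ G X} (f : Germ G X → ℂ)
    (h : γ ∈ Set.range (translate (G := G) v 1 w)) (hd : deg γ = v.length - w.length) :
    unblock v w (block v w f) γ = f γ := by
  obtain ⟨δ, rfl⟩ := h
  rw [deg_translate] at hd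
  rw [unblock_apply, (translate_injective v 1 w).extend_apply, block_apply _ _ _ (by linarith)]

theorem of_unblock_block_ne_zero {v w : List X} {γ : Germ G X} {f : Germ G X → ℂ}
    (h : unblock v w (block v w f) γ ≠ 0) :
    γ ∈ Set.range (translate (G := G) v 1 w) ∧ deg γ = v.length - w.length ∧ f γ ≠ 0 := by
  by_cases hr : γ ∈ Set.range (translate (G := G) v 1 w)
  · refine ⟨hr, ?_⟩
    obtain ⟨δ, rfl⟩ := hr
    rw [unblock_apply, (translate_injective v 1 w).extend_apply] at h
    have hd : deg δ = 0 := by_contra fun hd => h (block_apply_of_ne _ _ _ hd)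
    rw [block_apply _ _ _ hd] at h
    exact ⟨by rw [deg_translate, hd]; ring, h⟩
  · exact absurd (Function.extend_apply' _ _ _ hr) h

/-- A function supported in degrees of absolute value at most `n` is the sum of the functions
`unblock v w (block v w f)` over all `w` of length `n` and all `v` of length at most `2n`. The bound
makes `n + deg γ`, the length of `v` at a germ `γ`, nonnegative. -/
theorem mem_of_unblock_block_mem [Finite X] {J : Submodule ℂ (Germ G X → ℂ)} {f : Germ G X → ℂ}
    {n : ℕ} (hL : ∀ γ, f γ ≠ 0 → |deg γ| ≤ n)
    (h : ∀ v w : List X, w.length = n → unblock v w (block v w f) ∈ J) : f ∈ J := by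
  classical
  let s := (List.finite_length_le X (n + n)).toFinset ×ˢ (List.finite_length_eq X n).toFinset
  have hs : ∀ vw, vw ∈ s ↔ vw.1.length ≤ n + n ∧ vw.2.length = n := by
    simp [s]
  have key : f = ∑ vw ∈ s, unblock vw.1 vw.2 (block vw.1 vw.2 f) := by
    funext γ
    rw [Finset.sum_apply]
    by_cases h0 : f γ = 0
    · rw [h0, Finset.sum_eq_zero]
      exact fun vw _ => by_contra fun hne => (of_unblock_block_ne_zero hne).2.2 h0
    · have hd := abs_le.1 (hL γ h0)
      obtain ⟨m, hm⟩ := Int.eq_ofNat_of_zero_le (a := deg γ + n) (by linarith)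
      rw [Finset.sum_eq_single ((tgt γ).take m, (src γ).take n), unblock_block_apply]
      · exact mem_range_translate.2 ⟨⟨_, Stream'.append_take_drop _ _⟩,
          ⟨_, Stream'.append_take_drop _ _⟩⟩
      · simp; linarith
      · rintro ⟨v, w⟩ hvw hne
        have hw : w.length = n := ((hs _).1 hvw).2
        by_contra hz
        obtain ⟨hr, hdeg, -⟩ := of_unblock_block_ne_zero hz
        dsimp only at hr hdeg
        obtain ⟨⟨η, hη⟩, ⟨ζ, hζ⟩⟩ := mem_range_translate.1 hr
        have hv : v.length = m := by
          rw [hw] at hdeg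
          zify
          linarith [show (Int.ofNat m : ℤ) = m from rfl]
        refine hne (Prod.ext ?_ ?_)
        · change v = _
          rw [← hη, ← hv, take_append]
        · change w = _
          rw [← hζ, ← hw, take_append]
      · intro hns
        refine absurd ((hs _).2 ?_) hns
        simp only [Stream'.length_take, and_true]
        have := hd.2
        zify
        linarith [show (Int.ofNat m : ℤ) = m from rfl]
  rw [key]
  exact Submodule.sum_mem _ fun vw hvw => h _ _ ((hs _).1 hvw).2

theorem exists_abs_deg_le {f : Germ G X → ℂ} (hf : f ∈ ArrowGroupoid.algebra (Germ G X)) :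
    ∃ L : ℕ, ∀ γ, f γ ≠ 0 → |deg γ| ≤ L := by
  induction hf using Submodule.span_induction with
  | mem f hf =>
    obtain ⟨F, hc, -, -, rfl⟩ := hf
    obtain ⟨L, hL⟩ := (hc.image (continuous_deg (G := G) (X := X)).abs).bddAbove
    refine ⟨L.toNat, fun γ hγ => (hL ⟨γ, Set.mem_of_indicator_ne_zero hγ, rfl⟩).trans
      (Int.self_le_toNat L)⟩
  | zero => exact ⟨0, fun γ h => absurd rfl h⟩
  | add f g _ _ hf hg =>
    obtain ⟨L, hL⟩ := hf
    obtain ⟨L', hL'⟩ := hg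
    refine ⟨max L L', fun γ h => ?_⟩
    by_cases h0 : f γ = 0
    · exact (hL' γ fun h1 => h (by simp [h0, h1])).trans (by simp)
    · exact (hL γ h0).trans (by simp)
  | smul c f _ hf =>
    obtain ⟨L, hL⟩ := hf
    exact ⟨L, fun γ h => hL γ fun h0 => h (by simp [h0])⟩

/-- If a set of germs with injective source map is covered by slices contained in it, with source
words of length at most `n`, then each of its blocks with source words of length at least `n` is
zero or the full graph of a single group element. -/
theorem block_indicator_mem {N : Set G} (hN : IsAbsorbing G X N) {F : Set (Germ G X)}
    (hF : F.InjOn src) {n : ℕ}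
    (h : ∀ γ ∈ F, ∃ v g w, γ ∈ slice v g w ∧ slice v g w ⊆ F ∧ g ∈ N ∧ w.length ≤ n)
    (v w : List X) (hw : n ≤ w.length) :
    block v w (F.indicator 1) ∈ Submodule.span ℂ (unitaryElement X '' N) := by
  by_cases hex : ∃ γ : Germ G X, deg γ = 0 ∧ translate v 1 w γ ∈ F
  · obtain ⟨γ, hγ, hγF⟩ := hex
    obtain ⟨v', g', w', ⟨ξ, hξ⟩, hsub, hg', hw'⟩ := h _ hγF
    -- the slice containing the given germ restricts to a slice with source word `w`
    obtain ⟨u, rfl, rfl⟩ := exists_append_of_le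
      ((congrArg src hξ).trans (src_translate v 1 w γ)) (hw'.trans hw)
    have hdeg := congrArg deg hξ
    rw [deg_translate, deg_chart, hγ, List.length_append] at hdeg
    have ht := congrArg tgt hξ
    rw [chart_append, tgt_chart, tgt_translate] at ht
    have hv := (PreGerm.append_stream_inj ht (by
      rw [List.length_append, length_wordAct]
      push_cast at hdeg
      zify
      linarith)).1
    subst hv
    have hsub' := (slice_append_subset v' g' w' u).trans hsub
    refine Submodule.subset_span ⟨wordSect g' u, hN.wordSect_mem hg' u, ?_⟩
    rw [unitaryElement_eq]
    funext δ
    by_cases hδ : δ ∈ slice [] (wordSect g' u) []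
    · have h0 : deg δ = 0 := by
        obtain ⟨ζ, rfl⟩ := hδ
        rfl
      rw [Set.indicator_of_mem hδ, block_apply _ _ _ h0,
        Set.indicator_of_mem (hsub' (translate_mem_slice_iff.2 hδ))]
      rfl
    · rw [Set.indicator_of_notMem hδ]
      by_cases h0 : deg δ = 0
      · rw [block_apply _ _ _ h0, Set.indicator_of_notMem]
        intro hδF
        -- the germ of `wordSect g' u` at the source of `δ` is in the block, hence equals `δ`
        have hmem : chart [] (wordSect g' u) [] (src δ) ∈ slice [] (wordSect g' u) [] :=
          ⟨_, rfl⟩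
        have := hF (hsub' (translate_mem_slice_iff.2 hmem)) hδF (by
          rw [src_translate, src_translate]; rfl)
        exact hδ (translate_injective _ _ _ this ▸ hmem)
      · rw [block_apply_of_ne _ _ _ h0]
  · have : block v w (F.indicator 1) = 0 := by
      funext γ
      by_cases h0 : deg γ = 0
      · rw [block_apply _ _ _ h0, Set.indicator_of_notMem fun hγ => hex ⟨γ, h0, hγ⟩]
        rfl
      · rw [block_apply_of_ne _ _ _ h0]
        rfl
    rw [this]
    exact Submodule.zero_mem _

/-- The span of the unitary elements of an absorbing set is stable under taking blocks. -/
theorem block_mem_span {N : Set G} (hN : IsAbsorbing G X N) {f : Germ G X → ℂ}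
    (hf : f ∈ Submodule.span ℂ (unitaryElement X '' N)) (v w : List X) :
    block v w f ∈ Submodule.span ℂ (unitaryElement X '' N) := by
  induction hf using Submodule.span_induction with
  | mem f hf =>
    obtain ⟨g, hg, rfl⟩ := hf
    rw [unitaryElement_eq]
    exact block_indicator_mem hN (injOn_src_slice [] g [])
      (fun γ hγ => ⟨[], g, [], hγ, subset_rfl, hg, le_rfl⟩) v w (Nat.zero_le _)
  | zero => rw [map_zero]; exact Submodule.zero_mem _
  | add f g _ _ hf hg => rw [map_add]; exact Submodule.add_mem _ hf hg
  | smul c f _ hf => rw [map_smul]; exact Submodule.smul_mem _ c hf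

/-- This is where contraction is used: the blocks of an element of the algebra with sufficiently
long words are linear combinations of unitary elements of an absorbing set. -/
theorem exists_block_mem_span {N : Set G} (hN : IsAbsorbing G X N) {f : Germ G X → ℂ}
    (hf : f ∈ ArrowGroupoid.algebra (Germ G X)) :
    ∃ n : ℕ, ∀ v w : List X, n ≤ w.length →
      block v w f ∈ Submodule.span ℂ (unitaryElement X '' N) := by
  induction hf using Submodule.span_induction with
  | mem f hf =>
    obtain ⟨F, hc, ho, hb, rfl⟩ := hf
    have : ∃ n, ∀ γ ∈ F, ∃ v g w, γ ∈ slice v g w ∧ slice v g w ⊆ F ∧ g ∈ N ∧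
        w.length ≤ n := by
      refine hc.induction_on (p := fun S => ∃ n, ∀ γ ∈ S, ∃ v g w, γ ∈ slice v g w ∧
        slice v g w ⊆ F ∧ g ∈ N ∧ w.length ≤ n) ⟨0, by simp⟩ ?_ ?_ ?_
      · rintro S T hST ⟨n, hn⟩
        exact ⟨n, fun γ hγ => hn γ (hST hγ)⟩
      · rintro S T ⟨n, hn⟩ ⟨m, hm⟩
        refine ⟨max n m, ?_⟩
        rintro γ (hγ | hγ)
        · obtain ⟨v, g, w, h1, h2, h3, h4⟩ := hn γ hγ
          exact ⟨v, g, w, h1, h2, h3, h4.trans (le_max_left _ _)⟩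
        · obtain ⟨v, g, w, h1, h2, h3, h4⟩ := hm γ hγ
          exact ⟨v, g, w, h1, h2, h3, h4.trans (le_max_right _ _)⟩
      · intro γ hγ
        obtain ⟨v, g, w, ξ, rfl⟩ := exists_chart γ
        obtain ⟨n, hn⟩ := exists_slice_subset ho hγ
        obtain ⟨m, hm⟩ := hN.absorbs g
        refine ⟨_, mem_nhdsWithin_of_mem_nhds ((isOpen_slice _ _ _).mem_nhds
          (mem_slice_take v g w ξ (max n m))), _, fun δ hδ => ⟨_, _, _, hδ,
          hn _ (le_max_left _ _), ?_, le_rfl⟩⟩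
        exact hN.wordSect_mem_of_le hm (le_max_right n m) _ (Stream'.length_take _ _)
    obtain ⟨n, hn⟩ := this
    exact ⟨n, block_indicator_mem hN hb.injOn_src hn⟩
  | zero => exact ⟨0, fun v w _ => by rw [map_zero]; exact Submodule.zero_mem _⟩
  | add f g _ _ hf hg =>
    obtain ⟨n, hn⟩ := hf
    obtain ⟨m, hm⟩ := hg
    refine ⟨max n m, fun v w hw => ?_⟩
    rw [map_add]
    exact Submodule.add_mem _ (hn v w ((le_max_left _ _).trans hw))
      (hm v w ((le_max_right _ _).trans hw))
  | smul c f _ hf =>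
    obtain ⟨n, hn⟩ := hf
    refine ⟨n, fun v w hw => ?_⟩
    rw [map_smul]
    exact Submodule.smul_mem _ c (hn v w hw)

theorem unblock_mem_span_slice {N : Set G} {f : Germ G X → ℂ}
    (hf : f ∈ Submodule.span ℂ (unitaryElement X '' N)) (v w : List X) :
    unblock v w f ∈ Submodule.span ℂ
      {f | ∃ (v : List X) (g : G) (w : List X), f = (slice v g w).indicator 1} := by
  induction hf using Submodule.span_induction with
  | mem f hf =>
    obtain ⟨g, -, rfl⟩ := hf
    exact Submodule.subset_span ⟨v, g, w, unblock_unitaryElement v g w⟩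
  | zero => rw [map_zero]; exact Submodule.zero_mem _
  | add f g _ _ hf hg => rw [map_add]; exact Submodule.add_mem _ hf hg
  | smul c f _ hf => rw [map_smul]; exact Submodule.smul_mem _ c hf

/-- The algebra is spanned by the indicator functions of slices. -/
theorem algebra_le_span_slice [Finite X] (hc : IsContracting G X) :
    ArrowGroupoid.algebra (Germ G X) ≤ Submodule.span ℂ
      {f | ∃ (v : List X) (g : G) (w : List X), f = (slice v g w).indicator 1} := by
  intro f hf
  obtain ⟨n, hn⟩ := exists_block_mem_span (isLeast_nucleus hc).1 hf
  obtain ⟨L, hL⟩ := exists_abs_deg_le hf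
  refine mem_of_unblock_block_mem (n := max n L)
    (fun γ hγ => (hL γ hγ).trans (by simp)) fun v w hw => ?_
  exact unblock_mem_span_slice (hn v w (hw ▸ le_max_left _ _)) v w

end

end Germ

end SelfSimilar

/-! ### Transport of algebras and essential ideals along open maps -/

namespace ArrowGroupoid

section Transport

variable {Γ Γ' Ob Ob' : Type*} [ArrowGroupoid Γ Ob] [TopologicalSpace Γ] [TopologicalSpace Ob]
  [ArrowGroupoid Γ' Ob'] [TopologicalSpace Γ'] [TopologicalSpace Ob']

theorem comp_mem_algebra {i : Γ → Γ'}
    (hi : ∀ F : Set Γ', IsCompact F → IsOpen F → IsBisection F →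
      IsCompact (i ⁻¹' F) ∧ IsOpen (i ⁻¹' F) ∧ IsBisection (i ⁻¹' F))
    {f : Γ' → ℂ} (hf : f ∈ algebra Γ') : f ∘ i ∈ algebra Γ := by
  induction hf using Submodule.span_induction with
  | mem f hf =>
    obtain ⟨F, hc, ho, hb, rfl⟩ := hf
    obtain ⟨hc', ho', hb'⟩ := hi F hc ho hb
    exact indicator_mem_algebra hc' ho' hb'
  | zero => exact Submodule.zero_mem _
  | add f g _ _ hf hg => exact Submodule.add_mem _ hf hg
  | smul c f _ hf => exact Submodule.smul_mem _ c hf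

theorem extend_mem_algebra {i : Γ → Γ'} (hinj : Function.Injective i)
    (hi : ∀ F : Set Γ, IsCompact F → IsOpen F → IsBisection F →
      IsCompact (i '' F) ∧ IsOpen (i '' F) ∧ IsBisection (i '' F))
    {f : Γ → ℂ} (hf : f ∈ algebra Γ) : Function.extend i f 0 ∈ algebra Γ' := by
  change Function.ExtendByZero.linearMap ℂ i f ∈ _
  induction hf using Submodule.span_induction with
  | mem f hf =>
    obtain ⟨F, hc, ho, hb, rfl⟩ := hf
    obtain ⟨hc', ho', hb'⟩ := hi F hc ho hb
    have := indicator_mem_algebra hc' ho' hb'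
    rwa [← extend_indicator_zero hinj] at this
  | zero => rw [map_zero]; exact Submodule.zero_mem _
  | add f g _ _ hf hg => rw [map_add]; exact Submodule.add_mem _ hf hg
  | smul c f _ hf => rw [map_smul]; exact Submodule.smul_mem _ c hf

theorem comp_mem_essentialIdeal {i : Γ → Γ'} (ho : IsOpenMap i) {f : Γ' → ℂ}
    (hf : f ∈ essentialIdeal Γ') (h : f ∘ i ∈ algebra Γ) : f ∘ i ∈ essentialIdeal Γ := by
  refine ⟨h, Set.subset_empty_iff.1 ?_⟩
  have := ho.interior_preimage_subset_preimage_interior (s := Function.support f)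
  rwa [hf.2, Set.preimage_empty] at this

theorem extend_mem_essentialIdeal {i : Γ → Γ'} (ho : Topology.IsOpenEmbedding i) {f : Γ → ℂ}
    (hf : f ∈ essentialIdeal Γ) (h : Function.extend i f 0 ∈ algebra Γ') :
    Function.extend i f 0 ∈ essentialIdeal Γ' := by
  refine ⟨h, ?_⟩
  rw [support_extend_zero_eq_image ho.injective, interior_image_eq_empty ho]
  exact hf.2

end Transport

end ArrowGroupoid

namespace SelfSimilar

namespace Germ

section

variable {G X : Type*} [Group G] [MulAction G (Stream' X)] [IsSelfSimilar G X]
  [FaithfulSMul G (Stream' X)] [IsIsometricSMul G (Stream' X)]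

/-! ### The essential ideal is an ideal -/

open ArrowGroupoid

theorem comp_translate_mem_essentialIdeal [Finite X] {f : Germ G X → ℂ}
    (hf : f ∈ essentialIdeal (Germ G X)) (v : List X) (g : G) (w : List X) :
    f ∘ translate v g w ∈ essentialIdeal (Germ G X) := by
  refine comp_mem_essentialIdeal (isOpenEmbedding_translate v g w).isOpenMap hf
    (comp_mem_algebra (fun F hc ho hb => ?_) hf.1)
  have hc' := (isClosedEmbedding_translate v g w).isCompact_preimage hc
  refine ⟨hc', ho.preimage (continuous_translate v g w), isBisection_of_injOn hc' ?_ ?_⟩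
  · intro γ hγ δ hδ h
    have h' : src γ = src δ := h
    exact translate_injective v g w (hb.injOn_src hγ hδ (by
      change src (translate v g w γ) = src (translate v g w δ)
      rw [src_translate, src_translate, h']))
  · intro γ hγ δ hδ h
    have h' : tgt γ = tgt δ := h
    exact translate_injective v g w (hb.injOn_tgt hγ hδ (by
      change tgt (translate v g w γ) = tgt (translate v g w δ)
      rw [tgt_translate, tgt_translate, h']))

theorem extend_translate_mem_essentialIdeal {f : Germ G X → ℂ}
    (hf : f ∈ essentialIdeal (Germ G X)) (v : List X) (g : G) (w : List X) :
    Function.extend (translate v g w) f 0 ∈ essentialIdeal (Germ G X) := by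
  refine extend_mem_essentialIdeal (isOpenEmbedding_translate v g w) hf
    (extend_mem_algebra (translate_injective v g w) (fun F hc ho hb => ?_) hf.1)
  have hc' := hc.image (continuous_translate v g w)
  refine ⟨hc', (isOpenEmbedding_translate v g w).isOpenMap F ho,
    isBisection_of_injOn hc' ?_ ?_⟩
  · rintro _ ⟨γ, hγ, rfl⟩ _ ⟨δ, hδ, rfl⟩ h
    rw [src_translate, src_translate] at h
    exact congrArg _ (hb.injOn_src hγ hδ (append_stream_injective w h))
  · rintro _ ⟨γ, hγ, rfl⟩ _ ⟨δ, hδ, rfl⟩ h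
    rw [tgt_translate, tgt_translate] at h
    exact congrArg _ (hb.injOn_tgt hγ hδ (MulAction.injective g (append_stream_injective v h)))

/-- Inversion of germs is a homeomorphism. -/
def invHomeomorph : Germ G X ≃ₜ Germ G X where
  toFun := inv
  invFun := inv
  left_inv := inv_inv
  right_inv := inv_inv
  continuous_toFun := continuous_inv
  continuous_invFun := continuous_inv

theorem comp_inv_mem_algebra {f : Germ G X → ℂ} (hf : f ∈ algebra (Germ G X)) :
    f ∘ inv ∈ algebra (Germ G X) := by
  refine comp_mem_algebra (fun F hc ho hb => ?_) hf
  have hc' : IsCompact (inv ⁻¹' F) := invHomeomorph.isCompact_preimage.2 hc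
  refine ⟨hc', ho.preimage continuous_inv, isBisection_of_injOn hc' ?_ ?_⟩
  · intro γ hγ δ hδ h
    exact ArrowGroupoid.inv_involutive.injective (hb.injOn_tgt hγ hδ
      ((ArrowGroupoid.tgt_inv γ).trans (h.trans (ArrowGroupoid.tgt_inv δ).symm)))
  · intro γ hγ δ hδ h
    exact ArrowGroupoid.inv_involutive.injective (hb.injOn_src hγ hδ
      ((ArrowGroupoid.src_inv γ).trans (h.trans (ArrowGroupoid.src_inv δ).symm)))

theorem comp_inv_mem_essentialIdeal {f : Germ G X → ℂ} (hf : f ∈ essentialIdeal (Germ G X)) :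
    f ∘ inv ∈ essentialIdeal (Germ G X) :=
  comp_mem_essentialIdeal invHomeomorph.isOpenMap hf (comp_inv_mem_algebra hf.1)

theorem conv_mem_essentialIdeal_left [Finite X] (hc : IsContracting G X) {a f : Germ G X → ℂ}
    (ha : a ∈ algebra (Germ G X)) (hf : f ∈ essentialIdeal (Germ G X)) :
    conv a f ∈ essentialSubmodule (Germ G X) := by
  have hle : Submodule.span ℂ
      {f | ∃ (v : List X) (g : G) (w : List X), f = (slice v g w).indicator 1} ≤
        algebra (Germ G X) := by
    refine Submodule.span_le.2 ?_
    rintro _ ⟨v, g, w, rfl⟩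
    exact slice_mem_algebra v g w
  have ha' := algebra_le_span_slice hc ha
  induction ha' using Submodule.span_induction with
  | mem a ha' =>
    obtain ⟨v, g, w, rfl⟩ := ha'
    rw [conv_slice_left]
    exact extend_translate_mem_essentialIdeal (comp_translate_mem_essentialIdeal hf w 1 []) v g []
  | zero =>
    have : conv (0 : Germ G X → ℂ) f = 0 := by
      funext γ
      simp [conv]
    rw [this]
    exact Submodule.zero_mem _
  | add a b ha' hb' iha ihb =>
    rw [conv_add_left (hle ha') (hle hb')]
    exact Submodule.add_mem _ (iha (hle ha')) (ihb (hle hb'))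
  | smul c a ha' iha =>
    rw [conv_smul_left]
    exact Submodule.smul_mem _ c (iha (hle ha'))

/-- Stability under multiplication on the right follows from that on the left by inversion. -/
theorem conv_mem_essentialIdeal [Finite X] (hc : IsContracting G X) (a : Germ G X → ℂ)
    (ha : a ∈ algebra (Germ G X)) (f : Germ G X → ℂ) (hf : f ∈ essentialIdeal (Germ G X)) :
    conv a f ∈ essentialIdeal (Germ G X) ∧ conv f a ∈ essentialIdeal (Germ G X) := by
  refine ⟨conv_mem_essentialIdeal_left hc ha hf, ?_⟩
  rw [conv_eq_conv_comp_inv]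
  exact comp_inv_mem_essentialIdeal (conv_mem_essentialIdeal_left hc (comp_inv_mem_algebra ha)
    (comp_inv_mem_essentialIdeal hf))

theorem nucleusSpan_le_algebra [Finite X] :
    nucleusSpan G X ≤ algebra (Germ G X) := by
  refine Submodule.span_le.2 ?_
  rintro _ ⟨g, -, rfl⟩
  rw [unitaryElement_eq]
  exact slice_mem_algebra [] g []

/-! ### Generation of the essential ideal by the nucleus -/

theorem block_mem_essentialIdeal [Finite X] {f : Germ G X → ℂ}
    (hf : f ∈ essentialIdeal (Germ G X)) {v w : List X} (h : block v w f ∈ nucleusSpan G X) :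
    block v w f ∈ essentialIdeal (Germ G X) := by
  refine ⟨nucleusSpan_le_algebra h, Set.subset_empty_iff.1 ?_⟩
  rw [← (comp_translate_mem_essentialIdeal hf v 1 w).2]
  refine interior_mono fun γ hγ => ?_
  by_cases h0 : deg γ = 0
  · rwa [Function.mem_support, block_apply _ _ _ h0] at hγ
  · exact absurd (block_apply_of_ne _ _ _ h0) hγ

variable (G X) in
theorem essentialIdeal_eq [Finite X] (hc : IsContracting G X) :
    essentialIdeal (Germ G X) =
      (idealGeneratedBy (Germ G X)
        (essentialIdeal (Germ G X) ∩ (nucleusSpan G X : Set (Germ G X → ℂ))) :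
          Set (Germ G X → ℂ)) := by
  refine Set.Subset.antisymm (fun f hf => ?_)
    (idealGeneratedBy_subset_essentialIdeal (conv_mem_essentialIdeal hc) Set.inter_subset_left)
  refine Submodule.mem_sInf.2 ?_
  rintro J ⟨-, hS, hJ⟩
  obtain ⟨n, hn⟩ := exists_block_mem_span (isLeast_nucleus hc).1 hf.1
  obtain ⟨L, hL⟩ := exists_abs_deg_le hf.1
  refine mem_of_unblock_block_mem (n := max n L)
    (fun γ hγ => (hL γ hγ).trans (by simp)) fun v w hw => ?_
  have hb := hn v w (hw ▸ le_max_left _ _)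
  -- `unblock v w h` is the product of `s_v`, `h` and `s_w^*`
  have h := conv_slice_conv_slice v [] w [] (block v w f)
  rw [show block v w f ∘ translate [] 1 [] = block v w f from
    funext fun γ => congrArg _ (translate_nil γ), ← unblock_apply] at h
  rw [← h]
  exact (hJ _ (slice_mem_algebra _ _ _) _ (hJ _ (slice_mem_algebra _ _ _) _
    (hS ⟨block_mem_essentialIdeal hf hb, hb⟩)).2).1

end

end Germ

end SelfSimilar

/-! ### The subgroupoid of degree zero -/

namespace SelfSimilar

namespace GermZero

open ArrowGroupoid SelfSimilar.Germ

section

variable {G X : Type*} [Group G] [MulAction G (Stream' X)] [IsSelfSimilar G X]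

/-- The inclusion of the subgroupoid of germs of degree zero. -/
def val (γ : GermZero G X) : Germ G X := Subtype.val γ

theorem val_injective : Function.Injective (val : GermZero G X → Germ G X) :=
  Subtype.val_injective

theorem mem_range_val {γ : Germ G X} : γ ∈ Set.range (val : GermZero G X → Germ G X) ↔
    deg γ = 0 :=
  ⟨fun ⟨δ, h⟩ => h ▸ δ.2, fun h => ⟨⟨γ, h⟩, rfl⟩⟩

theorem range_val : Set.range (val : GermZero G X → Germ G X) = deg ⁻¹' {0} :=
  Set.ext fun _ => mem_range_val

theorem isOpenEmbedding_val :
    Topology.IsOpenEmbedding (val : GermZero G X → Germ G X) :=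
  ⟨Topology.IsEmbedding.subtypeVal,
    range_val (G := G) (X := X) ▸ (isOpen_discrete {0}).preimage continuous_deg⟩

theorem isClosedEmbedding_val :
    Topology.IsClosedEmbedding (val : GermZero G X → Germ G X) :=
  ⟨Topology.IsEmbedding.subtypeVal,
    range_val (G := G) (X := X) ▸ (isClosed_discrete {0}).preimage continuous_deg⟩

variable (G X) in
/-- Extension by zero of functions on the subgroupoid of germs of degree zero. -/
def extendZero : (GermZero G X → ℂ) →ₗ[ℂ] (Germ G X → ℂ) :=
  Function.ExtendByZero.linearMap ℂ val

theorem extendZero_val (f : GermZero G X → ℂ) (γ : GermZero G X) :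
    extendZero G X f (val γ) = f γ :=
  val_injective.extend_apply f 0 γ

theorem extendZero_of_deg_ne (f : GermZero G X → ℂ) {γ : Germ G X} (h : deg γ ≠ 0) :
    extendZero G X f γ = 0 :=
  Function.extend_apply' _ _ _ fun h' => h (mem_range_val.1 h')

theorem extendZero_comp_val (f : GermZero G X → ℂ) : extendZero G X f ∘ val = f :=
  funext (extendZero_val f)

theorem extendZero_injective : Function.Injective (extendZero G X) := fun f g h => by
  rw [← extendZero_comp_val f, h, extendZero_comp_val]

theorem extendZero_comp_val_of_support {f : Germ G X → ℂ} (h : ∀ γ, f γ ≠ 0 → deg γ = 0) :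
    extendZero G X (f ∘ val) = f := by
  funext γ
  by_cases h0 : deg γ = 0
  · exact extendZero_val (f ∘ val) ⟨γ, h0⟩
  · rw [extendZero_of_deg_ne _ h0]
    exact (by_contra fun h1 => h0 (h γ fun h2 => h1 h2.symm))

variable [FaithfulSMul G (Stream' X)]

/-- Extension by zero is multiplicative, since the degree is a cocycle. -/
theorem extendZero_conv (f₁ f₂ : GermZero G X → ℂ) :
    extendZero G X (conv f₁ f₂) = conv (extendZero G X f₁) (extendZero G X f₂) := by
  funext γ
  by_cases h0 : deg γ = 0
  · let φ : {p : GermZero G X × GermZero G X //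
          ∃ h : ArrowGroupoid.src p.1 = ArrowGroupoid.tgt p.2,
            ArrowGroupoid.mul p.1 p.2 h = ⟨γ, h0⟩} →
        {p : Germ G X × Germ G X // ∃ h : ArrowGroupoid.src p.1 = ArrowGroupoid.tgt p.2,
          ArrowGroupoid.mul p.1 p.2 h = γ} :=
      fun p => ⟨(val p.1.1, val p.1.2), p.2.1, congrArg val p.2.2⟩
    have hφ : Function.Injective φ := fun p q h => by
      have h' := Prod.ext_iff.1 (Subtype.ext_iff.1 h)
      exact Subtype.ext (Prod.ext (val_injective h'.1) (val_injective h'.2))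
    let F := fun p : {p : Germ G X × Germ G X //
        ∃ h : ArrowGroupoid.src p.1 = ArrowGroupoid.tgt p.2, ArrowGroupoid.mul p.1 p.2 h = γ} =>
      extendZero G X f₁ p.1.1 * extendZero G X f₂ p.1.2
    refine (extendZero_val (conv f₁ f₂) ⟨γ, h0⟩).trans (Eq.symm (Eq.trans ?_
      ((finsum_mem_range (f := F) hφ).trans (finsum_congr fun p => ?_))))
    · refine (finsum_mem_univ F).symm.trans
        (finsum_mem_inter_support_eq F Set.univ (Set.range φ) ?_)
      rw [Set.univ_inter, eq_comm, Set.inter_eq_right]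
      rintro ⟨⟨a, b⟩, h, e⟩ hp
      have ha : deg a = 0 := by_contra fun ha => left_ne_zero_of_mul hp (extendZero_of_deg_ne _ ha)
      have hb : deg b = 0 := by_contra fun hb => right_ne_zero_of_mul hp (extendZero_of_deg_ne _ hb)
      exact ⟨⟨(⟨a, ha⟩, ⟨b, hb⟩), h, Subtype.ext e⟩, rfl⟩
    · simp only [F, φ, extendZero_val]
  · rw [extendZero_of_deg_ne _ h0]
    refine (finsum_eq_zero_of_forall_eq_zero ?_).symm
    rintro ⟨⟨a, b⟩, h, e⟩
    by_cases ha : deg a = 0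
    · have hb : deg b ≠ 0 := fun hb => h0 (by
        rw [← e]
        exact (deg_mul a b h).trans (by rw [ha, hb, add_zero]))
      exact mul_eq_zero_of_right _ (extendZero_of_deg_ne _ hb)
    · exact mul_eq_zero_of_left (extendZero_of_deg_ne _ ha) _

variable [IsIsometricSMul G (Stream' X)]

theorem isBisection_of_injOn {F : Set (GermZero G X)} (hF : IsCompact F)
    (h₁ : F.InjOn ArrowGroupoid.src) (h₂ : F.InjOn ArrowGroupoid.tgt) : IsBisection F :=
  ArrowGroupoid.isBisection_of_injOn (continuous_src.comp continuous_subtype_val)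
    (continuous_tgt.comp continuous_subtype_val) hF h₁ h₂

theorem extendZero_mem_algebra {f : GermZero G X → ℂ} (hf : f ∈ algebra (GermZero G X)) :
    extendZero G X f ∈ algebra (Germ G X) := by
  refine extend_mem_algebra val_injective (fun F hc ho hb => ?_) hf
  have hc' := hc.image (isOpenEmbedding_val (G := G) (X := X)).continuous
  refine ⟨hc', isOpenEmbedding_val.isOpenMap F ho, Germ.isBisection_of_injOn hc' ?_ ?_⟩
  · rintro _ ⟨γ, hγ, rfl⟩ _ ⟨δ, hδ, rfl⟩ h
    exact congrArg _ (hb.injOn_src hγ hδ h)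
  · rintro _ ⟨γ, hγ, rfl⟩ _ ⟨δ, hδ, rfl⟩ h
    exact congrArg _ (hb.injOn_tgt hγ hδ h)

theorem comp_val_mem_algebra {f : Germ G X → ℂ} (hf : f ∈ algebra (Germ G X)) :
    f ∘ val ∈ algebra (GermZero G X) := by
  refine comp_mem_algebra (fun F hc ho hb => ?_) hf
  have hc' := (isClosedEmbedding_val (G := G) (X := X)).isCompact_preimage hc
  refine ⟨hc', ho.preimage isOpenEmbedding_val.continuous, isBisection_of_injOn hc' ?_ ?_⟩
  · exact fun γ hγ δ hδ h => val_injective (hb.injOn_src hγ hδ h)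
  · exact fun γ hγ δ hδ h => val_injective (hb.injOn_tgt hγ hδ h)

theorem extendZero_mem_essentialIdeal {f : GermZero G X → ℂ}
    (hf : f ∈ essentialIdeal (GermZero G X)) :
    extendZero G X f ∈ essentialIdeal (Germ G X) :=
  extend_mem_essentialIdeal isOpenEmbedding_val hf (extendZero_mem_algebra hf.1)

theorem comp_val_mem_essentialIdeal {f : Germ G X → ℂ} (hf : f ∈ essentialIdeal (Germ G X)) :
    f ∘ val ∈ essentialIdeal (GermZero G X) :=
  comp_mem_essentialIdeal isOpenEmbedding_val.isOpenMap hf (comp_val_mem_algebra hf.1)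

theorem conv_mem_essentialIdeal [Finite X] (hc : IsContracting G X) (a : GermZero G X → ℂ)
    (ha : a ∈ algebra (GermZero G X)) (f : GermZero G X → ℂ)
    (hf : f ∈ essentialIdeal (GermZero G X)) :
    conv a f ∈ essentialIdeal (GermZero G X) ∧ conv f a ∈ essentialIdeal (GermZero G X) := by
  have h := Germ.conv_mem_essentialIdeal hc _ (extendZero_mem_algebra ha) _
    (extendZero_mem_essentialIdeal hf)
  rw [← extendZero_conv, ← extendZero_conv] at h
  have h1 := comp_val_mem_essentialIdeal h.1
  have h2 := comp_val_mem_essentialIdeal h.2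
  rw [extendZero_comp_val] at h1 h2
  exact ⟨h1, h2⟩

theorem comp_val_mem_nucleusSpanZero {f : Germ G X → ℂ} (hf : f ∈ nucleusSpan G X) :
    f ∘ val ∈ nucleusSpanZero G X := by
  induction hf using Submodule.span_induction with
  | mem f hf =>
    obtain ⟨g, hg, rfl⟩ := hf
    exact Submodule.subset_span ⟨g, hg, rfl⟩
  | zero => exact Submodule.zero_mem _
  | add f g _ _ hf hg => exact Submodule.add_mem _ hf hg
  | smul c f _ hf => exact Submodule.smul_mem _ c hf

theorem deg_eq_zero_of_mem_nucleusSpan {f : Germ G X → ℂ} (hf : f ∈ nucleusSpan G X)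
    {γ : Germ G X} (h : f γ ≠ 0) : deg γ = 0 := by
  induction hf using Submodule.span_induction with
  | mem f hf =>
    obtain ⟨g, hg, rfl⟩ := hf
    obtain ⟨ξ, rfl⟩ := Set.mem_of_indicator_ne_zero h
    rfl
  | zero => exact absurd rfl h
  | add f g _ _ hf hg =>
    by_cases h0 : f γ = 0
    · exact hg fun h1 => h (by simp [h0, h1])
    · exact hf h0
  | smul c f _ hf => exact hf fun h0 => h (by simp [h0])

/-! ### Blocks of the essential elements of the nucleus span -/

variable (G X) in
/-- The intersection of the essential ideal with the span of the nucleus. -/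
def nucleusEssential : Submodule ℂ (Germ G X → ℂ) :=
  essentialSubmodule (Germ G X) ⊓ nucleusSpan G X

variable (G X) in
/-- The span of the blocks, at pairs of words of length `k`, of the elements of
`nucleusEssential`. -/
def blockSpan (k : ℕ) : Submodule ℂ (Germ G X → ℂ) :=
  Submodule.span ℂ {f | ∃ h ∈ nucleusEssential G X, ∃ v w : List X,
    v.length = k ∧ w.length = k ∧ f = block v w h}

theorem block_mem_nucleusEssential [Finite X] (hc : IsContracting G X) {f : Germ G X → ℂ}
    (hf : f ∈ nucleusEssential G X) (v w : List X) : block v w f ∈ nucleusEssential G X := by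
  have h := block_mem_span (isLeast_nucleus hc).1 hf.2 v w
  exact ⟨block_mem_essentialIdeal hf.1 h, h⟩

theorem block_block {a b : List X} (hl : a.length = b.length) (v w : List X)
    (f : Germ G X → ℂ) : block a b (block v w f) = block (v ++ a) (w ++ b) f := by
  funext γ
  by_cases h0 : deg γ = 0
  · rw [block_apply _ _ _ h0, block_apply _ _ _ h0, block_apply, translate_one_translate_one]
    rw [deg_translate, h0, hl]
    ring
  · rw [block_apply_of_ne _ _ _ h0, block_apply_of_ne _ _ _ h0]

theorem blockSpan_succ_le [Finite X] (hc : IsContracting G X) (k : ℕ) :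
    blockSpan G X (k + 1) ≤ blockSpan G X k := by
  refine Submodule.span_le.2 ?_
  rintro _ ⟨h, hh, v, w, hv, hw, rfl⟩
  obtain ⟨x, v, rfl⟩ := List.exists_cons_of_length_eq_add_one hv
  obtain ⟨y, w, rfl⟩ := List.exists_cons_of_length_eq_add_one hw
  have hv' : v.length = k := Nat.succ.inj hv
  have hw' : w.length = k := Nat.succ.inj hw
  exact Submodule.subset_span ⟨block [x] [y] h, block_mem_nucleusEssential hc hh [x] [y], v, w,
    hv', hw', (block_block (hv'.trans hw'.symm) [x] [y] h).symm⟩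

/-- The decreasing sequence `blockSpan` of finite-dimensional spaces stabilizes. -/
theorem exists_blockSpan_stable [Finite X] (hc : IsContracting G X) :
    ∃ K, ∀ k, K ≤ k → blockSpan G X k = blockSpan G X K := by
  have hfin : FiniteDimensional ℂ (nucleusSpan G X) :=
    FiniteDimensional.span_of_finite ℂ ((isLeast_nucleus hc).1.finite.image _)
  have hle : ∀ k, blockSpan G X k ≤ nucleusSpan G X := fun k => by
    refine Submodule.span_le.2 ?_
    rintro _ ⟨h, hh, v, w, -, -, rfl⟩
    exact (block_mem_nucleusEssential hc hh v w).2
  let d : ℕ → ℕ := fun k => Module.finrank ℂ (blockSpan G X k)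
  refine ⟨Function.argmin d, fun k hk => ?_⟩
  have := Submodule.finiteDimensional_of_le (hle (Function.argmin d))
  exact Submodule.eq_of_le_of_finrank_le (antitone_nat_of_succ_le (blockSpan_succ_le hc) hk)
    (Function.argmin_le d k)

/-! ### Generation of the essential ideal in degree zero -/

/-- In degree zero `unblock V W` is not multiplication by elements of the algebra. However, if
`f` is itself a block at words of the same length as `V` and `W`, then `unblock V W f` is a product
with `s_V s_v^*` and `s_w s_W^*`, which have degree zero. -/
theorem unblock_mem_map_extendZero [Finite X] {J : Submodule ℂ (GermZero G X → ℂ)}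
    (hS : essentialIdeal (GermZero G X) ∩ (nucleusSpanZero G X : Set (GermZero G X → ℂ)) ⊆ J)
    (hJ : ∀ a ∈ algebra (GermZero G X), ∀ f ∈ J, conv a f ∈ J ∧ conv f a ∈ J) {k : ℕ}
    {V W : List X} (hV : V.length = k) (hW : W.length = k) {f : Germ G X → ℂ}
    (hf : f ∈ blockSpan G X k) : unblock V W f ∈ J.map (extendZero G X) := by
  have hslice : ∀ v w : List X, v.length = k → w.length = k →
      ∃ s ∈ algebra (GermZero G X), extendZero G X s = (slice v (1 : G) w).indicator 1 := by
    intro v w hv hw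
    refine ⟨_, comp_val_mem_algebra (slice_mem_algebra v 1 w),
      extendZero_comp_val_of_support fun γ hγ => ?_⟩
    obtain ⟨ξ, rfl⟩ := Set.mem_of_indicator_ne_zero hγ
    rw [deg_chart, hv, hw, sub_self]
  induction hf using Submodule.span_induction with
  | mem f hf =>
    obtain ⟨h, hh, v, w, hv, hw, rfl⟩ := hf
    have hdeg : ∀ γ, h γ ≠ 0 → deg γ = 0 := fun γ => deg_eq_zero_of_mem_nucleusSpan hh.2
    have hb : block v w h = h ∘ translate v 1 w := by
      funext γ
      by_cases h0 : deg γ = 0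
      · exact block_apply _ _ _ h0
      · rw [block_apply_of_ne _ _ _ h0]
        refine (by_contra fun h1 => h0 ?_)
        have := hdeg _ fun h2 => h1 h2.symm
        rw [deg_translate, hv, hw] at this
        linarith
    obtain ⟨s, hs, es⟩ := hslice V v hV hv
    obtain ⟨t, ht, et⟩ := hslice w W hw hW
    refine ⟨conv s (conv (h ∘ val) t), ?_, ?_⟩
    · exact (hJ s hs _ (hJ t ht _
        (hS ⟨comp_val_mem_essentialIdeal hh.1, comp_val_mem_nucleusSpanZero hh.2⟩)).2).1
    · rw [extendZero_conv, extendZero_conv, es, et, extendZero_comp_val_of_support hdeg,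
        conv_slice_conv_slice, hb, unblock_apply]
  | zero => rw [map_zero]; exact Submodule.zero_mem _
  | add f g _ _ hf hg => rw [map_add]; exact Submodule.add_mem _ hf hg
  | smul c f _ hf => rw [map_smul]; exact Submodule.smul_mem _ c hf

variable (G X) in
theorem essentialIdeal_eq [Finite X] (hc : IsContracting G X) :
    essentialIdeal (GermZero G X) =
      (idealGeneratedBy (GermZero G X)
        (essentialIdeal (GermZero G X) ∩ (nucleusSpanZero G X : Set (GermZero G X → ℂ))) :
          Set (GermZero G X → ℂ)) := by
  refine Set.Subset.antisymm (fun f₀ hf₀ => ?_)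
    (idealGeneratedBy_subset_essentialIdeal (conv_mem_essentialIdeal hc) Set.inter_subset_left)
  refine Submodule.mem_sInf.2 ?_
  rintro J ⟨-, hS, hJ⟩
  suffices h : extendZero G X f₀ ∈ J.map (extendZero G X) by
    obtain ⟨f₁, h1, h2⟩ := h
    exact extendZero_injective h2 ▸ h1
  have hf := extendZero_mem_essentialIdeal hf₀
  have hdeg : ∀ γ, extendZero G X f₀ γ ≠ 0 → deg γ = 0 := fun γ hγ =>
    by_contra fun h => hγ (extendZero_of_deg_ne _ h)
  generalize extendZero G X f₀ = f at hf hdeg ⊢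
  obtain ⟨n, hn⟩ := exists_block_mem_span (isLeast_nucleus hc).1 hf.1
  obtain ⟨K, hK⟩ := exists_blockSpan_stable (G := G) (X := X) hc
  refine mem_of_unblock_block_mem (n := n + K) (fun γ hγ => ?_) fun V W hW => ?_
  · rw [hdeg γ hγ, abs_zero]
    positivity
  by_cases hV : V.length = n + K
  · refine unblock_mem_map_extendZero hS hJ hV hW ?_
    -- the block at `V = v ++ a` and `W = w ++ b` is the block at `a` and `b` of an element of
    -- the nucleus span, and `a` and `b` are long enough for the stable range
    rw [hK _ (Nat.le_add_left K n), ← List.take_append_drop n V, ← List.take_append_drop n W,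
      ← block_block (by simp [hV, hW])]
    have hb := hn (V.take n) (W.take n) (by simp [hW])
    exact Submodule.subset_span ⟨_, ⟨block_mem_essentialIdeal hf hb, hb⟩, V.drop n, W.drop n,
      by simp [hV], by simp [hW], rfl⟩
  · have : unblock V W (block V W f) = 0 := by
      funext γ
      by_contra hne
      obtain ⟨-, h1, h2⟩ := of_unblock_block_ne_zero hne
      rw [hdeg γ h2, hW] at h1
      exact hV (by zify; push_cast at h1; linarith)
    rw [this]
    exact Submodule.zero_mem _

end

end GermZero

end SelfSimilar

end

theorem mainTheorem4 (G X : Type*) [Group G] [Finite X] [MulAction G (Stream' X)]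
    [FaithfulSMul G (Stream' X)] [IsIsometricSMul G (Stream' X)] [IsSelfSimilar G X]
    (hc : SelfSimilar.IsContracting G X) :
    ArrowGroupoid.essentialIdeal (SelfSimilar.Germ G X) =
        (ArrowGroupoid.idealGeneratedBy (SelfSimilar.Germ G X)
          (ArrowGroupoid.essentialIdeal (SelfSimilar.Germ G X) ∩
            (SelfSimilar.nucleusSpan G X : Set (SelfSimilar.Germ G X → ℂ))) :
          Set (SelfSimilar.Germ G X → ℂ)) ∧
      ArrowGroupoid.essentialIdeal (SelfSimilar.GermZero G X) =
        (ArrowGroupoid.idealGeneratedBy (SelfSimilar.GermZero G X)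
          (ArrowGroupoid.essentialIdeal (SelfSimilar.GermZero G X) ∩
            (SelfSimilar.nucleusSpanZero G X : Set (SelfSimilar.GermZero G X → ℂ))) :
          Set (SelfSimilar.GermZero G X → ℂ)) :=
  ⟨SelfSimilar.Germ.essentialIdeal_eq G X hc, SelfSimilar.GermZero.essentialIdeal_eq G X hc⟩
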